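/- Let $f$ be a transcendental meromorphic function in the complex plane (i.e. meromorphic on $\mathbb C$ and not a rational function). Let $k\ge 1$ and let $q_0,q_1,\dots,q_k\ge 0$ be integers with $q_0\ge 1$ and $q_k\ge 1$. Put $$\mu=q_0+q_1+\cdots+q_k,\qquad \mu_*=q_1+2q_2+\cdots+kq_k,\qquad \psi=f^{q_0}(f')^{q_1}\cdots(f^{(k)})^{q_k},$$ and assume $\mu-\mu_*\ge 3$. Then for every nonzero complex number $a$, $$\Theta(a;\psi)\le 1-\frac{\mu-\mu_*-2}{\mu+\mu_*},\qquad\text{where}\quad \Theta(a;\psi)=1-\limsup_{r\to\infty}\frac{\overline N(r,a;\psi)}{T(r,\psi)}.$$ Here $T(r,\psi)$ is the Nevanlinna characteristic of $\psi$, and $\overline N(r,a;\psi)=\int_0^r\frac{\overline n(t)-\overline n(0)}{t}\,dt+\overline n(0)\log r$ is the reduced Nevanlinna counting function of the $a$-points of $\psi$, where $\overline n(t)$ is the number of distinct solutions of $\psi(z)=a$ in $|z|\le t$. -/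

import Mathlib

open Filter Topology

noncomputable section

namespace DiffMonomial

/-- A meromorphic function on `ℂ` is transcendental if it is not a rational function. Mathlib's
meromorphic functions may take arbitrary values on a discrete closed set, so they are compared with
rational functions off such a set. -/
def IsTranscendentalMeromorphic (f : ℂ → ℂ) : Prop :=
  Meromorphic f ∧
    ¬ ∃ P Q : Polynomial ℂ, Q ≠ 0 ∧ f =ᶠ[codiscrete ℂ] fun z => P.eval z / Q.eval z

/-- The degree `μ = q₀ + q₁ + ⋯ + q_k`. -/
def mu (k : ℕ) (q : ℕ → ℕ) : ℕ := ∑ i ∈ Finset.range (k + 1), q i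

/-- The number `μ_* = q₁ + 2 q₂ + ⋯ + k q_k`. -/
def muStar (k : ℕ) (q : ℕ → ℕ) : ℕ := ∑ i ∈ Finset.range (k + 1), i * q i

/-- The differential monomial `f ^ q₀ * (f') ^ q₁ * ⋯ * (f^(k)) ^ q_k`. -/
def monomial (k : ℕ) (q : ℕ → ℕ) (f : ℂ → ℂ) : ℂ → ℂ :=
  fun z => ∏ i ∈ Finset.range (k + 1), (iteratedDeriv i f z) ^ q i

/-- The reduced zero divisor of `D`: value `1` where `D` is positive and `0` elsewhere. -/
def reducedPos (D : Function.locallyFinsupp ℂ ℤ) : Function.locallyFinsupp ℂ ℤ where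
  toFun z := if 0 < D z then 1 else 0
  supportWithinDomain' := Set.subset_univ _
  supportLocallyFiniteWithinDomain' z hz := by
    obtain ⟨t, ht, hfin⟩ := D.supportLocallyFiniteWithinDomain' z hz
    refine ⟨t, ht, hfin.subset ?_⟩
    rintro w ⟨hw, hw'⟩
    refine ⟨hw, ?_⟩
    simp only [Function.mem_support, ne_eq, ite_eq_right_iff, one_ne_zero, imp_false,
      not_not] at hw'
    exact hw'.ne'

/-- The reduced Nevanlinna counting function `N̄(r, a; g)` of the `a`-points of `g`, each counted
once regardless of multiplicity. -/
def reducedLogCounting (g : ℂ → ℂ) (a : ℂ) : ℝ → ℝ :=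
  Function.locallyFinsuppWithin.logCounting
    (reducedPos (MeromorphicOn.divisor (fun z => g z - a) Set.univ))

/-- The ramification index `Θ(a; g) = 1 - limsup_{r → ∞} N̄(r, a; g) / T(r, g)`, where `T(r, g)` is
the Nevanlinna characteristic. The upper limit is taken in the extended reals, where it always
exists. -/
def ramificationIndex (a : ℂ) (g : ℂ → ℂ) : EReal :=
  1 - limsup (fun r : ℝ =>
    ((reducedLogCounting g a r / ValueDistribution.characteristic g ⊤ r : ℝ) : EReal)) atTop

end DiffMonomial

end

/-! Write μ, ν for `mu`, `muStar`, and let h = ψ'/(ψ - a). The argument rests on the identity 1/f^μ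
= a⁻¹ (ψ/f^μ - (ψ/f^μ)(ψ'/ψ) · 1/h). The logarithmic derivative lemma makes ψ/f^μ, ψ'/ψ and h error
terms in the proximity function, so μ m(r, 1/f) ≤ m(r, 1/h) + error. Jensen's formula for h turns
m(r, 1/h) into minus the counting function of the divisor of h, up to error.

Adding μ N(r, 1/f) to both sides leaves a pointwise comparison of divisors (`divisor_inequality`). A
zero of f of order n gives h a zero of order at least μn - ν - 1, so it costs at most ν + 1. A pole
of f costs 1, and an a-point of ψ costs 1 whatever its multiplicity. Bounding the zero and pole
counts of f by T(r, f) yields (μ - ν - 2) T(r, f) ≤ N̄(r, a; ψ) + error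
(`exists_mul_characteristic_le`). In the other direction T(r, ψ) ≤ (μ + ν) T(r, f) + error
(`exists_characteristic_monomial_le`). Dividing gives the lower bound for the upper limit.

Errors are kept as C log(2 + T(R, f) + R + 1/(R - r)) for all R > r, with no exceptional set.
Borel's growth lemma with R = r + 1/T(r, f) makes them o(T(r, f)) along some unbounded set of radii
(`frequently_log_gauge_le`), which suffices because an upper limit is bounded from below.
Transcendence enters through log r = o(T(r, f)) and through the nonvanishing of the derivatives of f
and of ψ'. -/

noncomputable section

namespace Nevanlinna

open Real Metric MeasureTheory Set ValueDistribution Function.locallyFinsuppWithin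

section

/-! ### The logarithmic derivative of a zero-free analytic function -/

theorem deriv_eq_zero_of_norm_eq_one {u : ℂ → ℂ} {w : ℂ}
    (hu : ∀ᶠ z in 𝓝 w, DifferentiableAt ℂ u z) (hnorm : ∀ᶠ z in 𝓝 w, ‖u z‖ = 1) : deriv u w = 0 := by
  have hmax : IsLocalMax (norm ∘ u) w := by
    filter_upwards [hnorm] with z hz
    simp [hz, hnorm.self_of_nhds]
  have hconst : u =ᶠ[𝓝 w] fun _ ↦ u w := Complex.eventually_eq_of_isLocalMax_norm hu hmax
  rw [hconst.deriv_eq, deriv_const]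

/-- The differentiated Poisson formula for the logarithm of a zero-free analytic function. -/
theorem logDeriv_eq_circleAverage {g : ℂ → ℂ} {ρ : ℝ} {w : ℂ}
    (hg : AnalyticOnNhd ℂ g (closedBall 0 ρ)) (hg0 : ∀ z ∈ closedBall (0 : ℂ) ρ, g z ≠ 0)
    (hw : w ∈ ball (0 : ℂ) ρ) :
    logDeriv g w =
      circleAverage (fun ζ ↦ (2 * ζ / (ζ - w) ^ 2) • ((log ‖g ζ‖ : ℝ) : ℂ)) 0 ρ := by
  have hρ : 0 < ρ := pos_of_mem_ball hw
  have hharm : InnerProductSpace.HarmonicOnNhd (fun z ↦ log ‖g z‖) (closedBall 0 ρ) :=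
    fun z hz ↦ (hg z hz).harmonicAt_log_norm (hg0 z hz)
  have hint : CircleIntegrable (fun z ↦ log ‖g z‖) 0 ρ := by
    apply MeromorphicOn.circleIntegrable_log_norm
    rw [abs_of_pos hρ]
    exact fun z hz ↦ (hg z (sphere_subset_closedBall hz)).meromorphicAt
  have hintC : CircleIntegrable (fun z ↦ ((log ‖g z‖ : ℝ) : ℂ)) 0 ρ := by
    simp only [CircleIntegrable, intervalIntegrable_iff] at hint ⊢
    exact Complex.ofRealCLM.integrable_comp hint
  -- By the Poisson formula the Herglotz integral H is a holomorphic function with real part log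
  -- ‖g‖. Hence exp(-H) g has modulus 1 and derivative 0, so g'/g = H', and H' is found by
  -- differentiating the kernel.
  set H : ℂ → ℂ := fun w ↦
    circleAverage (fun ζ ↦ herglotzRieszKernel 0 w ζ • ((log ‖g ζ‖ : ℝ) : ℂ)) 0 ρ with hH
  have hderiv := fun w (hw : w ∈ ball (0 : ℂ) ρ) ↦
    hasDerivAt_circleAverage_herglotzRieszKernel_smul hintC hw
  have hre : ∀ z ∈ ball (0 : ℂ) ρ, (H z).re = log ‖g z‖ := by
    intro z hz
    rw [hH, re_circleAverage_herglotzRieszKernel_smul hint hz]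
    exact hharm.circleAverage_re_herglotzRieszKernel_smul hz
  have hnhds : ∀ᶠ z in 𝓝 w, z ∈ ball (0 : ℂ) ρ := isOpen_ball.mem_nhds hw
  have hgd : ∀ z ∈ ball (0 : ℂ) ρ, DifferentiableAt ℂ g z :=
    fun z hz ↦ (hg z (ball_subset_closedBall hz)).differentiableAt
  have hu : deriv (fun z ↦ Complex.exp (-H z) * g z) w = 0 := by
    apply deriv_eq_zero_of_norm_eq_one
    · filter_upwards [hnhds] with z hz
      exact ((hderiv z hz).differentiableAt.neg.cexp).mul (hgd z hz)
    · filter_upwards [hnhds] with z hz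
      have : 0 < ‖g z‖ := norm_pos_iff.2 (hg0 z (ball_subset_closedBall hz))
      rw [norm_mul, Complex.norm_exp, Complex.neg_re, hre z hz, Real.exp_neg, Real.exp_log this,
        inv_mul_cancel₀ this.ne']
  have hu' : HasDerivAt (fun z ↦ Complex.exp (-H z) * g z) _ w :=
    ((hderiv w hw).neg.cexp).mul (hgd w hw).hasDerivAt
  rw [hu'.deriv] at hu
  have hgw : g w ≠ 0 := hg0 w (ball_subset_closedBall hw)
  have hexp := Complex.exp_ne_zero (-H w)
  rw [logDeriv_apply, div_eq_iff hgw]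
  set A := circleAverage (fun ζ ↦ (2 * ζ / (ζ - w) ^ 2) • ((log ‖g ζ‖ : ℝ) : ℂ)) 0 ρ
  replace hu : Complex.exp (-H w) * -A * g w + Complex.exp (-H w) * deriv g w = 0 := hu
  have : Complex.exp (-H w) * (deriv g w - A * g w) = 0 := by linear_combination hu
  rcases mul_eq_zero.1 this with h | h
  · exact absurd h hexp
  · exact sub_eq_zero.1 h

theorem norm_circleAverage_le_of_norm_le {F : ℂ → ℂ} {G : ℂ → ℝ} {ρ : ℝ}
    (hG : CircleIntegrable G 0 ρ) (h : ∀ z ∈ sphere (0 : ℂ) |ρ|, ‖F z‖ ≤ G z) :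
    ‖circleAverage F 0 ρ‖ ≤ circleAverage G 0 ρ := by
  rw [circleAverage, circleAverage, norm_smul, smul_eq_mul, norm_of_nonneg (by positivity)]
  gcongr
  apply intervalIntegral.norm_integral_le_of_norm_le two_pi_pos.le _ hG
  filter_upwards with θ _
  exact h _ (circleMap_mem_sphere' 0 ρ θ)

/-- A zero-free analytic function has a logarithmic derivative bounded by the mean of
`|log ‖g‖|` over a larger circle. -/
theorem norm_logDeriv_le {g : ℂ → ℂ} {ρ : ℝ} {w : ℂ}
    (hg : AnalyticOnNhd ℂ g (closedBall 0 ρ)) (hg0 : ∀ z ∈ closedBall (0 : ℂ) ρ, g z ≠ 0)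
    (hw : w ∈ ball (0 : ℂ) ρ) :
    ‖logDeriv g w‖ ≤ 2 * ρ / (ρ - ‖w‖) ^ 2 * circleAverage (fun z ↦ |log ‖g z‖|) 0 ρ := by
  have hρ : 0 < ρ := pos_of_mem_ball hw
  have hwρ : ‖w‖ < ρ := by simpa using hw
  have hint : CircleIntegrable (fun z ↦ |log ‖g z‖|) 0 ρ := by
    apply CircleIntegrable.abs
    apply MeromorphicOn.circleIntegrable_log_norm
    rw [abs_of_pos hρ]
    exact fun z hz ↦ (hg z (sphere_subset_closedBall hz)).meromorphicAt
  rw [logDeriv_eq_circleAverage hg hg0 hw, ← smul_eq_mul, ← circleAverage_fun_smul]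
  apply norm_circleAverage_le_of_norm_le
  · exact hint.const_smul
  · intro ζ hζ
    have hζ' : ‖ζ‖ = ρ := by simpa [abs_of_pos hρ] using hζ
    rw [norm_smul, norm_div, norm_mul, norm_pow, Complex.norm_real, norm_eq_abs, smul_eq_mul, hζ',
      Complex.norm_ofNat]
    gcongr
    rw [← hζ']
    exact norm_sub_norm_le ζ w

/-! ### Means of `‖z - a‖ ^ (-1/2)` -/

/-- Jordan's inequality sin t ≥ 2t/π on [0, π/2] reduces this to integrability of t^(-1/2).
Reflection in π/2 and the period π of |sin| give the rest. -/
theorem intervalIntegrable_inv_sqrt_abs_sin (a b : ℝ) :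
    IntervalIntegrable (fun t : ℝ ↦ (√|sin t|)⁻¹) volume a b := by
  have hper : Function.Periodic (fun t : ℝ ↦ (√|sin t|)⁻¹) π := fun t ↦ by simp [sin_add_pi]
  have hmeas : Measurable (fun t : ℝ ↦ (√|sin t|)⁻¹) := by fun_prop
  have h1 : IntervalIntegrable (fun t : ℝ ↦ (√|sin t|)⁻¹) volume 0 (π / 2) := by
    have hr : IntervalIntegrable (fun t : ℝ ↦ (√(2 / π))⁻¹ * t ^ (-(1 / 2) : ℝ)) volume 0 (π / 2) :=
      (intervalIntegral.intervalIntegrable_rpow' (by norm_num)).const_mul _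
    apply hr.mono_fun hmeas.aestronglyMeasurable
    filter_upwards [ae_restrict_mem measurableSet_uIoc] with t ht
    rw [uIoc_of_le (by positivity)] at ht
    have ht0 : 0 < t := ht.1
    have hs : 2 / π * t ≤ sin t := mul_le_sin ht0.le ht.2
    have hp : 0 < 2 / π * t := by positivity
    rw [norm_of_nonneg (by positivity), norm_of_nonneg (by positivity), rpow_neg ht0.le,
      ← sqrt_eq_rpow, ← mul_inv, ← sqrt_mul (by positivity), abs_of_pos (hp.trans_le hs)]
    gcongr
  have h2 : IntervalIntegrable (fun t : ℝ ↦ (√|sin t|)⁻¹) volume (π / 2) π := by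
    have := h1.comp_sub_left π
    simp only [sin_pi_sub, sub_zero, show π - π / 2 = π / 2 by ring] at this
    exact this.symm
  exact hper.intervalIntegrable₀ pi_ne_zero (h1.trans h2) a b

/-- Rotate a onto the nonnegative real axis and keep only the imaginary part of the difference. -/
theorem mul_abs_sin_le_norm_circleMap_sub {r : ℝ} (hr : 0 ≤ r) (a : ℂ) (θ : ℝ) :
    r * |sin (θ + -a.arg)| ≤ ‖circleMap 0 r θ - a‖ := by
  have h1 : (circleMap 0 r θ - a) * Complex.exp (-(a.arg * Complex.I)) =
      r * Complex.exp (((θ + -a.arg : ℝ) : ℂ) * Complex.I) - ‖a‖ := by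
    have ha : a * Complex.exp (-(a.arg * Complex.I)) = ‖a‖ := by
      nth_rw 1 [← Complex.norm_mul_exp_arg_mul_I a]
      rw [mul_assoc, ← Complex.exp_add]
      simp
    rw [sub_mul, ha, circleMap, zero_add, mul_assoc, ← Complex.exp_add]
    push_cast
    ring_nf
  have h2 : ‖circleMap 0 r θ - a‖ =
      ‖r * Complex.exp (((θ + -a.arg : ℝ) : ℂ) * Complex.I) - ‖a‖‖ := by
    rw [← h1, norm_mul, ← neg_mul, ← Complex.ofReal_neg, Complex.norm_exp_ofReal_mul_I, mul_one]
  rw [h2]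
  refine le_trans (le_of_eq ?_) (Complex.abs_im_le_norm _)
  rw [Complex.sub_im, Complex.ofReal_im, sub_zero, Complex.im_ofReal_mul,
    Complex.exp_ofReal_mul_I_im, abs_mul, abs_of_nonneg hr]

theorem measurable_inv_sqrt_norm_sub (a : ℂ) : Measurable fun z : ℂ ↦ (√‖z - a‖)⁻¹ := by
  fun_prop

theorem inv_sqrt_norm_circleMap_sub_le {r : ℝ} (hr : 1 ≤ r) (a : ℂ) {θ : ℝ}
    (hθ : sin (θ + -a.arg) ≠ 0) :
    (√‖circleMap 0 r θ - a‖)⁻¹ ≤ (√|sin (θ + -a.arg)|)⁻¹ := by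
  have h0 : 0 < |sin (θ + -a.arg)| := abs_pos.2 hθ
  have := mul_abs_sin_le_norm_circleMap_sub (by linarith : 0 ≤ r) a θ
  gcongr
  nlinarith

theorem ae_sin_add_ne_zero (c : ℝ) : ∀ᵐ θ : ℝ, sin (θ + c) ≠ 0 := by
  have : {θ : ℝ | sin (θ + c) = 0}.Countable := by
    apply (countable_range fun n : ℤ ↦ n * π - c).mono
    intro θ hθ
    obtain ⟨n, hn⟩ := sin_eq_zero_iff.1 hθ
    exact ⟨n, by simp [hn]⟩
  simpa [compl_ofPred] using this.ae_notMem volume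

theorem circleIntegrable_inv_sqrt_norm_sub {r : ℝ} (hr : 1 ≤ r) (a : ℂ) :
    CircleIntegrable (fun z ↦ (√‖z - a‖)⁻¹) 0 r := by
  have h := (intervalIntegrable_inv_sqrt_abs_sin (0 + -a.arg) (2 * π + -a.arg)).comp_add_right
    (-a.arg)
  simp only [add_sub_cancel_right] at h
  apply IntervalIntegrable.mono_fun h
  · exact ((measurable_inv_sqrt_norm_sub a).comp
      (continuous_circleMap 0 r).measurable).aestronglyMeasurable
  · filter_upwards [ae_restrict_of_ae (ae_sin_add_ne_zero (-a.arg))] with θ hθ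
    rw [norm_of_nonneg (by positivity), norm_of_nonneg (by positivity)]
    exact inv_sqrt_norm_circleMap_sub_le hr a hθ

/-- The bound is uniform in both the centre a and the radius r ≥ 1, so each zero or pole of f
contributes a fixed amount to the logarithmic derivative lemma. -/
theorem exists_circleAverage_inv_sqrt_norm_sub_le :
    ∃ C : ℝ, 0 ≤ C ∧ ∀ (a : ℂ) (r : ℝ), 1 ≤ r →
      circleAverage (fun z ↦ (√‖z - a‖)⁻¹) 0 r ≤ C := by
  have hper : Function.Periodic (fun t : ℝ ↦ (√|sin t|)⁻¹) (2 * π) :=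
    fun t ↦ by simp [sin_add_two_pi]
  refine ⟨(2 * π)⁻¹ * ∫ t in (0 : ℝ)..0 + 2 * π, (√|sin t|)⁻¹, ?_, ?_⟩
  · refine mul_nonneg (by positivity) ?_
    apply intervalIntegral.integral_nonneg (by rw [zero_add]; exact two_pi_pos.le)
    intro t _
    positivity
  · intro a r hr
    rw [circleAverage, smul_eq_mul, ← hper.intervalIntegral_add_eq (-a.arg) 0]
    gcongr
    have h := (intervalIntegrable_inv_sqrt_abs_sin (0 + -a.arg) (2 * π + -a.arg)).comp_add_right
      (-a.arg)
    simp only [add_sub_cancel_right] at h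
    have heq : ∫ t in (-a.arg)..(-a.arg + 2 * π), (√|sin t|)⁻¹ =
        ∫ θ in (0 : ℝ)..2 * π, (√|sin (θ + -a.arg)|)⁻¹ := by
      rw [intervalIntegral.integral_comp_add_right (fun t ↦ (√|sin t|)⁻¹), zero_add,
        add_comm (2 * π)]
    rw [heq]
    apply intervalIntegral.integral_mono_ae two_pi_pos.le
      (circleIntegrable_inv_sqrt_norm_sub hr a) h
    filter_upwards [ae_sin_add_ne_zero (-a.arg)] with θ hθ
    exact inv_sqrt_norm_circleMap_sub_le hr a hθ

end

section

/-! ### The logarithmic derivative lemma -/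

theorem abs_log_eq_posLog_add (x : ℝ) : |log x| = log⁺ x + log⁺ x⁻¹ := by
  rw [posLog_apply, posLog_apply, log_inv]
  rcases le_total 0 (log x) with h | h
  · simp [h]
  · simp [h, abs_of_nonpos]

theorem circleIntegrable_log_norm_sub (u : ℂ) (ρ : ℝ) :
    CircleIntegrable (fun z ↦ log ‖z - u‖) 0 ρ :=
  MeromorphicOn.circleIntegrable_log_norm (f := fun z ↦ z - u) fun z _ ↦ by fun_prop

theorem circleAverage_abs_log_norm_sub_le {ρ : ℝ} (hρ : 1 ≤ ρ) {u : ℂ} (hu : ‖u‖ ≤ ρ) :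
    circleAverage (fun z ↦ |log ‖z - u‖|) 0 ρ ≤ 2 * log (2 * ρ) := by
  have hint := circleIntegrable_log_norm_sub u ρ
  have hintp : CircleIntegrable (fun z ↦ log⁺ ‖z - u‖) 0 ρ :=
    MeromorphicOn.circleIntegrable_posLog_norm (f := fun z ↦ z - u) fun z _ ↦ by fun_prop
  have h1 : circleAverage (fun z ↦ |log ‖z - u‖|) 0 ρ =
      2 * circleAverage (fun z ↦ log⁺ ‖z - u‖) 0 ρ - circleAverage (fun z ↦ log ‖z - u‖) 0 ρ := by
    have h2 : CircleIntegrable (fun z ↦ (2 : ℝ) • log⁺ ‖z - u‖) 0 ρ := hintp.const_smul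
    rw [← smul_eq_mul, ← circleAverage_fun_smul, ← circleAverage_fun_sub h2 hint]
    congr 1
    ext z
    rw [smul_eq_mul, abs_log_eq_posLog_add, ← posLog_sub_posLog_inv]
    ring
  -- Since |log x| = 2 log⁺ x - log x, a nonnegative mean of the logarithm can be dropped, and only
  -- log⁺ needs an upper bound.
  have h2 : 0 ≤ circleAverage (fun z ↦ log ‖z - u‖) 0 ρ := by
    rw [circleAverage_log_norm_sub_const_eq_log_radius_add_posLog (by linarith)]
    exact add_nonneg (log_nonneg hρ) posLog_nonneg
  have h3 : circleAverage (fun z ↦ log⁺ ‖z - u‖) 0 ρ ≤ log (2 * ρ) := by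
    apply circleAverage_mono_on_of_le_circle hintp
    intro z hz
    have hz' : ‖z‖ = ρ := by simpa [abs_of_pos (by linarith : 0 < ρ)] using hz
    rw [← posLog_eq_log (by rw [abs_of_pos] <;> linarith)]
    apply posLog_le_posLog (norm_nonneg _)
    linarith [norm_sub_le z u]
  linarith

theorem circleAverage_abs_log_norm {f : ℂ → ℂ} (hf : Meromorphic f) (ρ : ℝ) :
    circleAverage (fun z ↦ |log ‖f z‖|) 0 ρ = proximity f ⊤ ρ + proximity f⁻¹ ⊤ ρ := by
  have hintp : CircleIntegrable (fun z ↦ log⁺ ‖f z‖) 0 ρ :=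
    hf.meromorphicOn.circleIntegrable_posLog_norm
  have hintq : CircleIntegrable (fun z ↦ log⁺ ‖f⁻¹ z‖) 0 ρ :=
    hf.inv.meromorphicOn.circleIntegrable_posLog_norm
  rw [proximity_top, proximity_top, ← circleAverage_fun_add hintp hintq]
  congr 1
  ext z
  rw [abs_log_eq_posLog_add, Pi.inv_apply, norm_inv]

/-- Removing zeros and poles changes the mean of `|log ‖f‖|` in a controlled way. -/
theorem circleAverage_abs_log_norm_le {f g : ℂ → ℂ} {U : Set ℂ}
    {D : Function.locallyFinsuppWithin U ℤ} {ρ : ℝ} (hf : Meromorphic f) (hρ : 1 ≤ ρ)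
    (hU : sphere 0 ρ ⊆ U) (hfin : D.support.Finite) (hsupp : ∀ u, D u ≠ 0 → ‖u‖ ≤ ρ)
    (hg0 : ∀ u : U, g u ≠ 0)
    (h : f =ᶠ[codiscreteWithin U] (∏ᶠ u, (· - u) ^ D u) • g) :
    circleAverage (fun z ↦ |log ‖g z‖|) 0 ρ ≤
      proximity f ⊤ ρ + proximity f⁻¹ ⊤ ρ +
        (∑ u ∈ hfin.toFinset, |(D u : ℝ)|) * (2 * log (2 * ρ)) := by
  have hρ0 : 0 < ρ := by linarith
  have hlog := MeromorphicOn.extract_zeros_poles_log hg0 h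
  have hsum : ∀ z, (∑ᶠ u, (D u * log ‖· - u‖) : ℂ → ℝ) z =
      ∑ u ∈ hfin.toFinset, D u * log ‖z - u‖ := by
    intro z
    rw [finsum_eq_sum_of_support_subset (s := hfin.toFinset), Finset.sum_apply]
    intro u hu
    simp only [Finite.coe_toFinset, Function.mem_support]
    rintro h0
    apply hu
    ext z
    simp [h0]
  have heq : (fun z ↦ |log ‖g z‖|) =ᶠ[codiscreteWithin (sphere 0 |ρ|)]
      fun z ↦ |log ‖f z‖ - ∑ u ∈ hfin.toFinset, D u * log ‖z - u‖| := by
    rw [abs_of_pos hρ0]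
    filter_upwards [hlog.filter_mono (codiscreteWithin_mono hU)] with z hz
    rw [hz, Pi.add_apply, hsum]
    congr 1
    ring
  have hint1 : CircleIntegrable (fun z ↦ log ‖f z‖) 0 ρ :=
    hf.meromorphicOn.circleIntegrable_log_norm
  have hint2 : ∀ u ∈ hfin.toFinset, CircleIntegrable (fun z ↦ D u * log ‖z - u‖) 0 ρ :=
    fun u _ ↦ (circleIntegrable_log_norm_sub u ρ).const_mul _
  have hint3 : ∀ u ∈ hfin.toFinset, CircleIntegrable (fun z ↦ |(D u : ℝ)| * |log ‖z - u‖|) 0 ρ :=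
    fun u _ ↦ (circleIntegrable_log_norm_sub u ρ).abs.const_mul _
  have hint4 : CircleIntegrable (fun z ↦ ∑ u ∈ hfin.toFinset, |(D u : ℝ)| * |log ‖z - u‖|) 0 ρ :=
    CircleIntegrable.fun_sum _ hint3
  rw [circleAverage_congr_codiscreteWithin heq hρ0.ne', ← circleAverage_abs_log_norm hf]
  calc circleAverage (fun z ↦ |log ‖f z‖ - ∑ u ∈ hfin.toFinset, D u * log ‖z - u‖|) 0 ρ
      ≤ circleAverage
          (fun z ↦ |log ‖f z‖| + ∑ u ∈ hfin.toFinset, |(D u : ℝ)| * |log ‖z - u‖|) 0 ρ := by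
        apply circleAverage_mono
        · exact (hint1.sub (CircleIntegrable.fun_sum _ hint2)).abs
        · exact hint1.abs.add hint4
        · intro z _
          refine (abs_sub _ _).trans (add_le_add le_rfl ((Finset.abs_sum_le_sum_abs _ _).trans ?_))
          simp [abs_mul]
    _ = circleAverage (fun z ↦ |log ‖f z‖|) 0 ρ +
          ∑ u ∈ hfin.toFinset, |(D u : ℝ)| * circleAverage (fun z ↦ |log ‖z - u‖|) 0 ρ := by
        have hint5 : CircleIntegrable (fun z ↦ |log ‖f z‖|) 0 ρ := hint1.abs
        rw [circleAverage_fun_add hint5 hint4, circleAverage_fun_sum hint3]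
        congr 1
        apply Finset.sum_congr rfl
        intro u _
        rw [← smul_eq_mul, ← circleAverage_fun_smul]
        rfl
    _ ≤ _ := by
        rw [Finset.sum_mul]
        gcongr with u hu
        exact circleAverage_abs_log_norm_sub_le hρ (hsupp u (by simpa using hu))

/-- The number of points of a divisor in a disk is controlled by the counting function on a larger
disk. -/
theorem sum_le_logCounting {D : Function.locallyFinsupp ℂ ℤ} (hD : 0 ≤ D) {ρ R : ℝ} (hρ : 1 ≤ ρ)
    (hR : ρ < R) (s : Finset ℂ) (hs : ∀ u ∈ s, ‖u‖ ≤ ρ) :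
    ∑ u ∈ s, (D u : ℝ) ≤ R / (R - ρ) * logCounting D R := by
  classical
  have hle : ∑ u ∈ s, single u (D u) ≤ D := by
    intro w
    simp only [coe_sum, Finset.sum_apply, single_apply, Finset.sum_ite_eq]
    split_ifs
    · exact le_rfl
    · exact hD w
  have hR0 : 0 < R := by linarith
  have h1 := logCounting_le hle (show 1 ≤ R by linarith)
  have h2 : ∑ u ∈ s, (D u : ℝ) * ((R - ρ) / R) ≤ logCounting D R := by
    refine le_trans ?_ h1
    rw [map_sum, Finset.sum_apply]
    apply Finset.sum_le_sum
    intro u hu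
    rw [logCounting_single_eq_log_sub_const ((hs u hu).trans hR.le)]
    have hDu : (0 : ℝ) ≤ D u := by exact_mod_cast hD u
    refine mul_le_mul_of_nonneg_left ?_ hDu
    -- Each point counts at least log(R/ρ) ≥ (R - ρ)/R. The origin is included, because the
    -- convention log 0 = 0 makes its term log R.
    have h3 : log ‖u‖ ≤ log ρ := by
      rcases (norm_nonneg u).eq_or_lt with h | h
      · rw [← h, log_zero]; exact log_nonneg hρ
      · exact log_le_log h (hs u hu)
    have h4 := one_sub_inv_le_log_of_pos (show 0 < R / ρ by positivity)
    rw [log_div hR0.ne' (by linarith), inv_div] at h4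
    rw [sub_div, div_self hR0.ne']
    linarith
  rw [← Finset.sum_mul] at h2
  have h5 : 0 < R - ρ := by linarith
  calc ∑ u ∈ s, (D u : ℝ) = R / (R - ρ) * ((∑ u ∈ s, (D u : ℝ)) * ((R - ρ) / R)) := by
        field_simp
    _ ≤ _ := by gcongr

theorem posLog_le_two_mul_log_one_add_sqrt (x : ℝ) (hx : 0 ≤ x) : log⁺ x ≤ 2 * log (1 + √x) := by
  rw [posLog_apply, max_le_iff]
  constructor
  · have := log_nonneg (show 1 ≤ 1 + √x by linarith [sqrt_nonneg x])
    linarith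
  · rcases hx.eq_or_lt with h | h
    · simp [← h]
    · have h1 : log x = 2 * log (√x) := by
        rw [log_sqrt hx]; ring
      rw [h1]
      have := log_le_log (sqrt_pos.2 h) (show √x ≤ 1 + √x by linarith)
      linarith

/-- Concavity of the logarithm: a bound on the mean of `‖F‖ ^ (1/2)` bounds the mean of
`log⁺ ‖F‖`. -/
theorem circleAverage_posLog_le {F : ℂ → ℂ} {G : ℂ → ℝ} {r B : ℝ}
    (hF : MeromorphicOn F (sphere 0 |r|)) (hG : CircleIntegrable G 0 r)
    (h : ∀ z ∈ sphere (0 : ℂ) |r|, √‖F z‖ ≤ G z) (hB : circleAverage G 0 r ≤ B) :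
    circleAverage (fun z ↦ log⁺ ‖F z‖) 0 r ≤ 2 * log (1 + B) := by
  have hB0 : 0 ≤ B :=
    (circleAverage_nonneg_of_nonneg fun z hz ↦ (sqrt_nonneg _).trans (h z hz)).trans hB
  -- c is the slope at y = B of the concave function 2 log(1 + y), which is bounded by its tangent
  -- there. The tangent has the value 2 log(1 + B) at y = B.
  set c := 2 / (1 + B)
  have hc : 0 < c := by positivity
  calc circleAverage (fun z ↦ log⁺ ‖F z‖) 0 r
      ≤ circleAverage (fun z ↦ c • G z + (2 * log (1 + B) + c - 2)) 0 r := by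
        apply circleAverage_mono hF.circleIntegrable_posLog_norm
        · exact hG.const_smul.add (circleIntegrable_const _ _ _)
        · intro z hz
          have h1 := posLog_le_two_mul_log_one_add_sqrt ‖F z‖ (norm_nonneg _)
          have hpos : 0 < 1 + √‖F z‖ := by positivity
          have h2 := log_le_sub_one_of_pos (show 0 < (1 + √‖F z‖) / (1 + B) by positivity)
          rw [log_div hpos.ne' (by positivity)] at h2
          have h3 : (1 + √‖F z‖) / (1 + B) ≤ (1 + G z) / (1 + B) := by
            gcongr
            exact h z hz
          have h4 : (1 + G z) / (1 + B) = (c + c * G z) / 2 := by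
            simp only [c]
            field_simp
          rw [smul_eq_mul]
          linarith
    _ = c * circleAverage G 0 r + (2 * log (1 + B) + c - 2) := by
        have hG' : CircleIntegrable (fun z ↦ c • G z) 0 r := hG.const_smul
        rw [circleAverage_fun_add hG' (circleIntegrable_const _ _ _),
          circleAverage_const, circleAverage_fun_smul, smul_eq_mul]
    _ ≤ c * B + (2 * log (1 + B) + c - 2) := by gcongr
    _ = 2 * log (1 + B) := by
        simp only [c]
        field_simp
        ring

theorem sqrt_sum_le {ι : Type*} (s : Finset ι) (a : ι → ℝ) (ha : ∀ i ∈ s, 0 ≤ a i) :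
    √(∑ i ∈ s, a i) ≤ ∑ i ∈ s, √(a i) := by
  rw [sqrt_le_left (Finset.sum_nonneg fun i _ ↦ sqrt_nonneg _)]
  calc ∑ i ∈ s, a i = ∑ i ∈ s, √(a i) ^ 2 :=
        Finset.sum_congr rfl fun i hi ↦ (sq_sqrt (ha i hi)).symm
    _ ≤ _ := Finset.sum_sq_le_sq_sum_of_nonneg fun i _ ↦ sqrt_nonneg _

end

section

/-! ### Error bounds for logarithmic derivatives through factorization on a disk. -/

theorem logDeriv_eventuallyEq_of_factorization {f g : ℂ → ℂ} {U : Set ℂ}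
    {D : Function.locallyFinsuppWithin U ℤ} (hf : Meromorphic f) (hfin : D.support.Finite)
    (hg : AnalyticOnNhd ℂ g U) (hg0 : ∀ u : U, g u ≠ 0)
    (h : f =ᶠ[codiscreteWithin U] (∏ᶠ u, (· - u) ^ D u) • g) :
    logDeriv f =ᶠ[codiscreteWithin U]
      fun z ↦ ∑ u ∈ hfin.toFinset, (D u : ℂ) * (z - u)⁻¹ + logDeriv g z := by
  set φ : ℂ → ℂ := ∏ᶠ u, (· - u) ^ D u
  have hφ : MeromorphicOn φ U := (Function.FactorizedRational.meromorphicNFOn D U).meromorphicOn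
  have hgm : MeromorphicOn g U := hg.meromorphicOn
  have h1 := hf.meromorphicOn.deriv_eventuallyEq_codiscreteWithin (hφ.mul hgm) h
  have h2 := hφ.logDeriv_mul_eventuallyEq hgm
    (fun x _ ↦ Function.FactorizedRational.meromorphicOrderAt_ne_top D)
    (fun x hx ↦ by
      rw [(hg x hx).meromorphicOrderAt_eq, (hg x hx).analyticOrderAt_eq_zero.2 (hg0 ⟨x, hx⟩)]
      simp)
  have h3 := MeromorphicOn.logDeriv_finprod_zpow_eventuallyEq (U := U)
    (F := fun (u : ℂ) (z : ℂ) ↦ z - u) (d := D) hfin (fun u z _ ↦ by fun_prop)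
    (fun u z _ ↦ by
      by_cases hzu : z = u
      · subst hzu; simp
      · have hzu' : AnalyticAt ℂ (fun z ↦ z - u) z := by fun_prop
        rw [hzu'.meromorphicOrderAt_eq, hzu'.analyticOrderAt_eq_zero.2 (sub_ne_zero.2 hzu)]
        simp)
  filter_upwards [h, h1, h2, h3] with z hz h1z h2z h3z
  have h4 : logDeriv f z = logDeriv (φ * g) z := by
    rw [logDeriv_apply, logDeriv_apply, hz, h1z]
    rfl
  rw [h4, h2z, Pi.add_apply]
  congr 1
  rw [h3z, finsum_eq_sum_of_support_subset (s := hfin.toFinset)]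
  · apply Finset.sum_congr rfl
    intro u _
    rw [zsmul_eq_mul, logDeriv_apply, deriv_sub_const, deriv_id'', one_div]
  · intro u hu
    simp only [Finite.coe_toFinset, Function.mem_support]
    rintro h0
    apply hu
    simp [h0]

/-- A version of the logarithmic derivative lemma with explicit error terms. -/
theorem exists_proximity_logDeriv_le_of_lt :
    ∃ C : ℝ, 0 ≤ C ∧ ∀ f : ℂ → ℂ, Meromorphic f → (∀ z, meromorphicOrderAt f z ≠ ⊤) →
      ∀ r ρ R : ℝ, 1 ≤ r → r < ρ → ρ < R →
      ∃ n : ℝ, 0 ≤ n ∧ n ≤ R / (R - ρ) * (logCounting f ⊤ R + logCounting f⁻¹ ⊤ R) ∧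
        proximity (logDeriv f) ⊤ r ≤ 2 * log (1 + (1 + 2 * ρ / (ρ - r) ^ 2 *
          (proximity f ⊤ ρ + proximity f⁻¹ ⊤ ρ + n * (2 * log (2 * ρ))) + n * C)) := by
  obtain ⟨C, hC0, hC⟩ := exists_circleAverage_inv_sqrt_norm_sub_le
  refine ⟨C, hC0, fun f hf htop r ρ R hr hrρ hρR ↦ ?_⟩
  have hρ1 : 1 ≤ ρ := by linarith
  set U := closedBall (0 : ℂ) ρ with hU
  set D := MeromorphicOn.divisor f U with hD
  have hfin : D.support.Finite := D.finiteSupport (isCompact_closedBall 0 ρ)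
  obtain ⟨g, hg, hg0, hfg⟩ := hf.meromorphicOn.extract_zeros_poles (fun u ↦ htop u) hfin
  have hsupp : ∀ u, D u ≠ 0 → ‖u‖ ≤ ρ := by
    intro u hu
    simpa [hU] using D.supportWithinDomain hu
  have hlogD := logDeriv_eventuallyEq_of_factorization hf hfin hg hg0 hfg
  -- n counts the zeros and poles in the closed disk of radius ρ with multiplicity. On the smaller
  -- circle f'/f is a sum of n simple fractions plus g'/g for a zero-free g. Means of square roots
  -- control the fractions, and the differentiated Poisson formula controls g'/g.
  set n := ∑ u ∈ hfin.toFinset, |(D u : ℝ)| with hn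
  refine ⟨n, Finset.sum_nonneg fun u _ ↦ abs_nonneg _, ?_, ?_⟩
  · set E := MeromorphicOn.divisor f univ with hE
    have hDE : ∀ u ∈ hfin.toFinset, |(D u : ℝ)| = ((E⁺ + E⁻ : Function.locallyFinsupp ℂ ℤ) u : ℝ) := by
      intro u hu
      have huU : u ∈ U := D.supportWithinDomain (by simpa using hu)
      have : D u = E u := by
        rw [hD, hE, MeromorphicOn.divisor_apply hf.meromorphicOn huU,
          MeromorphicOn.divisor_apply hf.meromorphicOn (mem_univ u)]
      rw [this, Function.locallyFinsuppWithin.coe_add, Pi.add_apply, posPart_apply, negPart_apply,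
        posPart_add_negPart]
      push_cast
      rfl
    rw [hn, Finset.sum_congr rfl hDE, ValueDistribution.logCounting_top,
      ValueDistribution.logCounting_inv, ValueDistribution.logCounting_zero,
      add_comm (Function.locallyFinsuppWithin.logCounting _ R)]
    have hadd := congrFun (map_add Function.locallyFinsuppWithin.logCounting E⁺ E⁻) R
    rw [Pi.add_apply] at hadd
    rw [← hadd]
    apply sum_le_logCounting _ hρ1 hρR
    · intro u hu
      exact hsupp u (by simpa using hu)
    · exact add_nonneg (posPart_nonneg _) (negPart_nonneg _)
  · set A := proximity f ⊤ ρ + proximity f⁻¹ ⊤ ρ + n * (2 * log (2 * ρ))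
    set K := 2 * ρ / (ρ - r) ^ 2 * A
    have hA : circleAverage (fun z ↦ |log ‖g z‖|) 0 ρ ≤ A :=
      circleAverage_abs_log_norm_le hf hρ1 sphere_subset_closedBall hfin hsupp hg0 hfg
    have hr0 : 0 < r := by linarith
    have hsph : sphere (0 : ℂ) |r| ⊆ U := by
      rw [abs_of_pos hr0]
      exact sphere_subset_closedBall.trans (closedBall_subset_closedBall hrρ.le)
    have hgK : ∀ z ∈ sphere (0 : ℂ) |r|, ‖logDeriv g z‖ ≤ K := by
      intro z hz
      have hz' : ‖z‖ = r := by simpa [abs_of_pos hr0] using hz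
      have h1 := norm_logDeriv_le (w := z) hg (fun u hu ↦ hg0 ⟨u, hu⟩) (by simpa [hz'] using hrρ)
      rw [hz'] at h1
      exact h1.trans (mul_le_mul_of_nonneg_left hA (by positivity))
    have hK0 : 0 ≤ K := by
      obtain ⟨z, hz⟩ := NormedSpace.sphere_nonempty (x := (0 : ℂ)) |>.2 (abs_nonneg r)
      exact (norm_nonneg _).trans (hgK z hz)
    rw [proximity_congr_codiscreteWithin (hlogD.filter_mono (codiscreteWithin_mono hsph)) hr0.ne',
      proximity_top]
    set G : ℂ → ℝ := fun z ↦ (1 + K) + ∑ u ∈ hfin.toFinset, |(D u : ℝ)| * (√‖z - u‖)⁻¹ with hG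
    have hint : ∀ u ∈ hfin.toFinset,
        CircleIntegrable (fun z : ℂ ↦ |(D u : ℝ)| * (√‖z - u‖)⁻¹) 0 r :=
      fun u _ ↦ (circleIntegrable_inv_sqrt_norm_sub hr u).const_mul _
    have hGint : CircleIntegrable G 0 r :=
      (circleIntegrable_const _ _ _).add (CircleIntegrable.fun_sum _ hint)
    apply circleAverage_posLog_le (G := G)
    · intro z hz
      have hgz := hg z (hsph hz)
      exact (MeromorphicAt.fun_sum fun u _ ↦ by fun_prop).add hgz.meromorphicAt.logDeriv
    · exact hGint
    · intro z hz
      have h1 : ‖∑ u ∈ hfin.toFinset, (D u : ℂ) * (z - u)⁻¹ + logDeriv g z‖ ≤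
          ∑ u ∈ hfin.toFinset, |(D u : ℝ)| * ‖z - u‖⁻¹ + K := by
        refine (norm_add_le _ _).trans (add_le_add ((norm_sum_le _ _).trans ?_) (hgK z hz))
        simp
      have h2 : √(∑ u ∈ hfin.toFinset, |(D u : ℝ)| * ‖z - u‖⁻¹) ≤
          ∑ u ∈ hfin.toFinset, |(D u : ℝ)| * (√‖z - u‖)⁻¹ := by
        refine (sqrt_sum_le _ _ fun u _ ↦ by positivity).trans ?_
        apply Finset.sum_le_sum
        intro u hu
        rw [sqrt_mul (abs_nonneg _), sqrt_inv]
        gcongr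
        -- Multiplicities are integers, so √|D u| ≤ |D u| and the bound stays linear in n.
        have h3 : (1 : ℝ) ≤ |(D u : ℝ)| := by
          exact_mod_cast Int.one_le_abs (by simpa using hu)
        rw [sqrt_le_left (abs_nonneg _)]
        nlinarith
      have h3 : √K ≤ 1 + K := by
        rw [sqrt_le_left (by positivity)]
        nlinarith
      have h4 : ∀ a b : ℝ, 0 ≤ a → 0 ≤ b → √(a + b) ≤ √a + √b := by
        intro a b ha hb
        rw [sqrt_le_left (by positivity)]
        nlinarith [sq_sqrt ha, sq_sqrt hb, mul_nonneg (sqrt_nonneg a) (sqrt_nonneg b)]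
      refine (sqrt_le_sqrt h1).trans ((h4 _ _ (Finset.sum_nonneg fun u _ ↦ by positivity) hK0).trans ?_)
      simp only [hG]
      linarith
    · have h1 : circleAverage G 0 r = (1 + K) +
          ∑ u ∈ hfin.toFinset, |(D u : ℝ)| * circleAverage (fun z ↦ (√‖z - u‖)⁻¹) 0 r := by
        rw [hG, circleAverage_fun_add (circleIntegrable_const _ _ _)
          (CircleIntegrable.fun_sum _ hint), circleAverage_const, circleAverage_fun_sum hint]
        congr 1
        apply Finset.sum_congr rfl
        intro u _
        rw [← smul_eq_mul, ← circleAverage_fun_smul]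
        rfl
      rw [h1, hn, Finset.sum_mul]
      gcongr with u hu
      exact hC u r hr

/-- The gauge in which error terms are measured. -/
def gauge (f : ℂ → ℂ) (r R : ℝ) : ℝ := 2 + characteristic f ⊤ R + R + 1 / (R - r)

theorem two_le_gauge {f : ℂ → ℂ} {r R : ℝ} (hr : 1 ≤ r) (hR : r < R) : 2 ≤ gauge f r R := by
  have h1 := characteristic_nonneg (f := f) (a := ⊤) (show 1 ≤ R by linarith)
  have h2 : 0 < 1 / (R - r) := one_div_pos.2 (by linarith)
  unfold gauge
  linarith

theorem characteristic_inv_le {f : ℂ → ℂ} (hf : Meromorphic f) :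
    ∃ A : ℝ, 0 ≤ A ∧ ∀ r, |characteristic f ⊤ r - characteristic f⁻¹ ⊤ r| ≤ A :=
  ⟨_, (abs_nonneg _).trans (characteristic_sub_characteristic_inv_le (R := 1) hf),
    fun _ ↦ characteristic_sub_characteristic_inv_le hf⟩

theorem proximity_le_characteristic {f : ℂ → ℂ} {r : ℝ} (hr : 1 ≤ r) :
    proximity f ⊤ r ≤ characteristic f ⊤ r := by
  have := ValueDistribution.logCounting_nonneg (f := f) (e := ⊤) hr
  simp only [characteristic, Pi.add_apply]
  linarith

theorem logCounting_le_characteristic {f : ℂ → ℂ} {r : ℝ} :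
    ValueDistribution.logCounting f ⊤ r ≤ characteristic f ⊤ r := by
  have : 0 ≤ proximity f ⊤ r := proximity_nonneg r
  simp only [characteristic, Pi.add_apply]
  linarith

/-- The **logarithmic derivative lemma**. -/
theorem exists_proximity_logDeriv_le {f : ℂ → ℂ} (hf : Meromorphic f)
    (htop : ∀ z, meromorphicOrderAt f z ≠ ⊤) :
    ∃ C : ℝ, 0 ≤ C ∧ ∀ r R : ℝ, 1 ≤ r → r < R →
      proximity (logDeriv f) ⊤ r ≤ C * log (gauge f r R) := by
  obtain ⟨C, hC0, hC⟩ := exists_proximity_logDeriv_le_of_lt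
  obtain ⟨A, hA0, hA⟩ := characteristic_inv_le hf
  set B := 2 + A
  set M := 2 + 72 * B + 2 * B * C
  have hM : 2 ≤ M := by
    have : 0 ≤ B := by positivity
    have : 0 ≤ B * C := by positivity
    linarith
  have hl2 : 0 < log 2 := log_pos (by norm_num)
  have hlM : 0 ≤ log M := log_nonneg (by linarith)
  -- The quantity inside the logarithm will be at most M X^7, where X is the gauge. So the bound is
  -- 2 log M + 14 log X, and X ≥ 2 absorbs log M into a multiple of log X.
  refine ⟨2 * log M / log 2 + 14, by positivity, fun r R hr hR ↦ ?_⟩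
  set X := gauge f r R with hX
  have hX2 : 2 ≤ X := two_le_gauge hr hR
  have hd : 0 < 1 / (R - r) := one_div_pos.2 (by linarith)
  have hT0 := characteristic_nonneg (f := f) (a := ⊤) (show 1 ≤ R by linarith)
  have hXT : characteristic f ⊤ R ≤ X := by simp only [hX, gauge]; linarith
  have hXR : R ≤ X := by simp only [hX, gauge]; linarith
  have hXd : 1 / (R - r) ≤ X := by simp only [hX, gauge]; linarith
  set ρ := (r + R) / 2 with hρ
  obtain ⟨n, hn0, hn, hprox⟩ := hC f hf htop r ρ R hr (by simp only [hρ]; linarith)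
    (by simp only [hρ]; linarith)
  have hρ1 : 1 ≤ ρ := by simp only [hρ]; linarith
  have hρR : ρ ≤ R := by simp only [hρ]; linarith
  have hTρ : characteristic f ⊤ ρ ≤ characteristic f ⊤ R :=
    characteristic_monotoneOn hf (by simp only [mem_Ioi]; linarith)
      (by simp only [mem_Ioi]; linarith) hρR
  have h1 : proximity f ⊤ ρ ≤ X := (proximity_le_characteristic hρ1).trans (hTρ.trans hXT)
  have h2 : proximity f⁻¹ ⊤ ρ ≤ X + A := by
    have := (abs_le.1 (hA ρ)).1
    have := proximity_le_characteristic (f := f⁻¹) hρ1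
    linarith
  have h3 : ValueDistribution.logCounting f ⊤ R ≤ X := logCounting_le_characteristic.trans hXT
  have h4 : ValueDistribution.logCounting f⁻¹ ⊤ R ≤ X + A := by
    have := (abs_le.1 (hA R)).1
    have := logCounting_le_characteristic (f := f⁻¹) (r := R)
    linarith
  have hXX : A ≤ A * X := by nlinarith
  have hRρ : R / (R - ρ) ≤ 2 * X ^ 2 := by
    have : R / (R - ρ) = 2 * (R * (1 / (R - r))) := by
      have : R - r ≠ 0 := by linarith
      have : R - ρ = (R - r) / 2 := by simp only [hρ]; ring
      rw [this]
      field_simp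
    rw [this, sq]
    gcongr
  have hn' : n ≤ 2 * B * X ^ 3 := by
    refine hn.trans ?_
    calc R / (R - ρ) * (ValueDistribution.logCounting f ⊤ R + ValueDistribution.logCounting f⁻¹ ⊤ R)
        ≤ 2 * X ^ 2 * (B * X) := by
          have h5 : 0 ≤ ValueDistribution.logCounting f ⊤ R +
              ValueDistribution.logCounting f⁻¹ ⊤ R :=
            add_nonneg (ValueDistribution.logCounting_nonneg (by linarith))
              (ValueDistribution.logCounting_nonneg (by linarith))
          apply mul_le_mul hRρ _ h5 (by positivity)
          simp only [B]
          linarith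
      _ = 2 * B * X ^ 3 := by ring
  have hlog : 0 ≤ 2 * log (2 * ρ) ∧ 2 * log (2 * ρ) ≤ 4 * X := by
    constructor
    · have := log_nonneg (show 1 ≤ 2 * ρ by linarith)
      linarith
    · have := log_le_self (show 0 ≤ 2 * ρ by linarith)
      linarith
  have hX1 : 1 ≤ X := by linarith
  have hB0 : 0 ≤ B := by positivity
  have h6 : proximity f ⊤ ρ + proximity f⁻¹ ⊤ ρ + n * (2 * log (2 * ρ)) ≤ 9 * B * X ^ 4 := by
    have h7 : n * (2 * log (2 * ρ)) ≤ 2 * B * X ^ 3 * (4 * X) :=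
      mul_le_mul hn' hlog.2 hlog.1 (by positivity)
    have h8 : proximity f ⊤ ρ + proximity f⁻¹ ⊤ ρ ≤ B * X ^ 1 := by
      simp only [B]
      linarith
    have h9 : B * X ^ 1 ≤ B * X ^ 4 := by gcongr; omega
    calc _ ≤ B * X ^ 4 + 2 * B * X ^ 3 * (4 * X) := add_le_add (h8.trans h9) h7
      _ = _ := by ring
  have h7 : 2 * ρ / (ρ - r) ^ 2 ≤ 8 * X ^ 3 := by
    have : 2 * ρ / (ρ - r) ^ 2 = 8 * (ρ * (1 / (R - r)) ^ 2) := by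
      have : R - r ≠ 0 := by linarith
      have : ρ - r = (R - r) / 2 := by simp only [hρ]; ring
      rw [this]
      field_simp
      ring
    rw [this]
    calc 8 * (ρ * (1 / (R - r)) ^ 2) ≤ 8 * (X * X ^ 2) := by
          gcongr
          linarith
      _ = 8 * X ^ 3 := by ring
  -- The exponent 7 comes from X^3 for the kernel factor times X^4 for the mean of |log ‖g‖|.
  have h8 : 1 + (1 + 2 * ρ / (ρ - r) ^ 2 *
      (proximity f ⊤ ρ + proximity f⁻¹ ⊤ ρ + n * (2 * log (2 * ρ))) + n * C) ≤ M * X ^ 7 := by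
    have h9 : 2 * ρ / (ρ - r) ^ 2 *
        (proximity f ⊤ ρ + proximity f⁻¹ ⊤ ρ + n * (2 * log (2 * ρ))) ≤
        8 * X ^ 3 * (9 * B * X ^ 4) := by
      have h10 : 0 ≤ 2 * ρ / (ρ - r) ^ 2 := by positivity
      calc _ ≤ 2 * ρ / (ρ - r) ^ 2 * (9 * B * X ^ 4) := by gcongr
        _ ≤ _ := by gcongr
    have h10 : n * C ≤ 2 * B * X ^ 3 * C := by gcongr
    have h11 : 2 * B * C * X ^ 3 ≤ 2 * B * C * X ^ 7 := by gcongr; omega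
    have h12 : 1 ≤ X ^ 7 := one_le_pow₀ hX1
    simp only [M]
    linarith
  refine hprox.trans ?_
  have hpos : 0 < 1 + (1 + 2 * ρ / (ρ - r) ^ 2 *
      (proximity f ⊤ ρ + proximity f⁻¹ ⊤ ρ + n * (2 * log (2 * ρ))) + n * C) := by
    have h9 : 0 ≤ proximity f ⊤ ρ := proximity_nonneg ρ
    have h10 : 0 ≤ proximity f⁻¹ ⊤ ρ := proximity_nonneg ρ
    have h11 := hlog.1
    positivity
  have h9 := log_le_log hpos h8
  rw [log_mul (x := M) (by linarith) (by positivity), log_pow] at h9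
  have h10 : log 2 ≤ log X := log_le_log (by norm_num) hX2
  have h11 : log M ≤ log M / log 2 * log X := by
    rw [div_mul_eq_mul_div, le_div_iff₀ hl2]
    gcongr
  push_cast at h9
  have h12 : (2 * log M / log 2 + 14) * log X = 2 * (log M / log 2 * log X) + 14 * log X := by
    ring
  rw [h12]
  linarith

end

section

/-! ### Divisors of derivatives -/

theorem divisor_apply_of_meromorphic {g : ℂ → ℂ} (hg : Meromorphic g) (z : ℂ) :
    MeromorphicOn.divisor g univ z = (meromorphicOrderAt g z).untop₀ :=
  MeromorphicOn.divisor_apply hg.meromorphicOn (mem_univ z)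

theorem divisor_deriv_eq_sub_one {g : ℂ → ℂ} (hg : Meromorphic g) {z : ℂ}
    (h : MeromorphicOn.divisor g univ z ≠ 0) :
    MeromorphicOn.divisor (deriv g) univ z = MeromorphicOn.divisor g univ z - 1 := by
  rw [divisor_apply_of_meromorphic hg] at h ⊢
  rw [divisor_apply_of_meromorphic hg.deriv]
  have htop : meromorphicOrderAt g z ≠ ⊤ := by
    intro h'
    simp [h'] at h
  rw [meromorphicOrderAt_deriv_eq_sub_one (by exact_mod_cast h)
    (WithTop.coe_untop₀_of_ne_top htop).symm, WithTop.untop₀_coe]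

theorem meromorphicOrderAt_deriv_nonneg {g : ℂ → ℂ} {z : ℂ} (hg : MeromorphicAt g z)
    (h : 0 ≤ meromorphicOrderAt g z) : 0 ≤ meromorphicOrderAt (deriv g) z := by
  obtain ⟨F, hF, hgF⟩ := hg.meromorphicOrderAt_nonneg_iff.1 h
  exact hg.deriv.meromorphicOrderAt_nonneg_iff.2 ⟨deriv F, hF.deriv, hgF.nhdsNE_deriv⟩

theorem divisor_deriv_nonneg {g : ℂ → ℂ} (hg : Meromorphic g) {z : ℂ}
    (h : 0 ≤ MeromorphicOn.divisor g univ z) : 0 ≤ MeromorphicOn.divisor (deriv g) univ z := by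
  rw [divisor_apply_of_meromorphic hg, WithTop.untop₀_nonneg] at h
  rw [divisor_apply_of_meromorphic hg.deriv, WithTop.untop₀_nonneg]
  exact meromorphicOrderAt_deriv_nonneg (hg z) h

theorem meromorphic_iteratedDeriv {g : ℂ → ℂ} (hg : Meromorphic g) (i : ℕ) :
    Meromorphic (iteratedDeriv i g) := by
  induction i with
  | zero => simpa using hg
  | succ i ih => rw [iteratedDeriv_succ]; exact ih.deriv

theorem divisor_iteratedDeriv_nonneg {g : ℂ → ℂ} (hg : Meromorphic g) {z : ℂ}
    (h : 0 ≤ MeromorphicOn.divisor g univ z) (i : ℕ) :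
    0 ≤ MeromorphicOn.divisor (iteratedDeriv i g) univ z := by
  induction i with
  | zero => simpa using h
  | succ i ih =>
    rw [iteratedDeriv_succ]
    exact divisor_deriv_nonneg (meromorphic_iteratedDeriv hg i) ih

theorem divisor_sub_le_divisor_iteratedDeriv {g : ℂ → ℂ} (hg : Meromorphic g) (z : ℂ) (i : ℕ) :
    MeromorphicOn.divisor g univ z - i ≤ MeromorphicOn.divisor (iteratedDeriv i g) univ z := by
  induction i with
  | zero => simp
  | succ i ih =>
    have hm := meromorphic_iteratedDeriv hg i
    rw [iteratedDeriv_succ]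
    push_cast
    by_cases h : MeromorphicOn.divisor (iteratedDeriv i g) univ z = 0
    · have := divisor_deriv_nonneg hm h.ge
      omega
    · rw [divisor_deriv_eq_sub_one hm h]
      omega

theorem divisor_iteratedDeriv_of_neg {g : ℂ → ℂ} (hg : Meromorphic g) {z : ℂ}
    (h : MeromorphicOn.divisor g univ z < 0) (i : ℕ) :
    MeromorphicOn.divisor (iteratedDeriv i g) univ z = MeromorphicOn.divisor g univ z - i := by
  induction i with
  | zero => simp
  | succ i ih =>
    rw [iteratedDeriv_succ, divisor_deriv_eq_sub_one (meromorphic_iteratedDeriv hg i) (by omega), ih]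
    push_cast
    ring

/-- A pole of order p becomes one of order p + 1 ≤ 2p, and no other poles appear. -/
theorem negPart_divisor_deriv_le {g : ℂ → ℂ} (hg : Meromorphic g) :
    (MeromorphicOn.divisor (deriv g) univ)⁻ ≤ 2 • (MeromorphicOn.divisor g univ)⁻ := by
  intro z
  rw [coe_nsmul, Pi.smul_apply, nsmul_eq_mul, negPart_apply, negPart_apply, negPart_def,
    negPart_def]
  by_cases h : MeromorphicOn.divisor g univ z < 0
  · rw [divisor_deriv_eq_sub_one hg h.ne]
    push_cast
    omega
  · have := divisor_deriv_nonneg hg (not_lt.1 h)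
    push_cast
    omega

theorem divisor_sub_const_of_neg {g : ℂ → ℂ} (hg : Meromorphic g) (a : ℂ) {z : ℂ}
    (h : MeromorphicOn.divisor g univ z < 0) :
    MeromorphicOn.divisor (fun z ↦ g z - a) univ z = MeromorphicOn.divisor g univ z := by
  classical
  have hga : Meromorphic fun z ↦ g z - a := fun z ↦ (hg z).sub (.const a z)
  rw [divisor_apply_of_meromorphic hg] at h ⊢
  rw [divisor_apply_of_meromorphic hga]
  congr 1
  have h0 : meromorphicOrderAt g z < 0 := by
    by_contra h'
    exact absurd (WithTop.untop₀_nonneg.2 (not_lt.1 h')) (not_le.2 h)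
  have := meromorphicOrderAt_add_eq_left_of_lt (f₁ := g) (f₂ := fun _ ↦ -a) (x := z)
    (MeromorphicAt.const _ _) (h0.trans_le analyticAt_const.meromorphicOrderAt_nonneg)
  rw [← this]
  congr 1

theorem divisor_sub_const_of_pos {g : ℂ → ℂ} (hg : Meromorphic g) {a : ℂ} (ha : a ≠ 0) {z : ℂ}
    (h : 0 < MeromorphicOn.divisor g univ z) :
    MeromorphicOn.divisor (fun z ↦ g z - a) univ z = 0 := by
  classical
  have hga : Meromorphic fun z ↦ g z - a := fun z ↦ (hg z).sub (.const a z)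
  rw [divisor_apply_of_meromorphic hg] at h
  rw [divisor_apply_of_meromorphic hga]
  have hconst : meromorphicOrderAt (fun _ : ℂ ↦ -a) z = 0 := by
    rw [meromorphicOrderAt_const, if_neg (neg_ne_zero.2 ha)]
  have h0 : 0 < meromorphicOrderAt g z := by
    by_contra h'
    have h1 : meromorphicOrderAt g z ≠ ⊤ := fun h2 ↦ h' (by simp [h2])
    lift meromorphicOrderAt g z to ℤ using h1 with n
    simp only [WithTop.untop₀_coe] at h
    exact h' (by exact_mod_cast h)
  have := meromorphicOrderAt_add_eq_right_of_lt (f₁ := g) (f₂ := fun _ ↦ -a) (x := z)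
    (hg z) (by rwa [hconst])
  have heq : (g + fun _ ↦ -a) = fun z ↦ g z - a := by
    ext z
    simp [sub_eq_add_neg]
  rw [← heq, this, hconst]
  simp

theorem divisor_sub_const_nonneg {g : ℂ → ℂ} (hg : Meromorphic g) (a : ℂ) {z : ℂ}
    (h : 0 ≤ MeromorphicOn.divisor g univ z) :
    0 ≤ MeromorphicOn.divisor (fun z ↦ g z - a) univ z := by
  have hga : Meromorphic fun z ↦ g z - a := fun z ↦ (hg z).sub (.const a z)
  rw [divisor_apply_of_meromorphic hg, WithTop.untop₀_nonneg] at h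
  rw [divisor_apply_of_meromorphic hga, WithTop.untop₀_nonneg]
  obtain ⟨F, hF, hgF⟩ := (hg z).meromorphicOrderAt_nonneg_iff.1 h
  refine (hga z).meromorphicOrderAt_nonneg_iff.2 ⟨fun z ↦ F z - a, hF.sub analyticAt_const, ?_⟩
  filter_upwards [hgF] with w hw
  rw [hw]

/-! ### Small and controlled functions -/

/-- Functions whose proximity function is an error term relative to `f`. -/
def IsSmall (f g : ℂ → ℂ) : Prop :=
  Meromorphic g ∧ ∃ C : ℝ, 0 ≤ C ∧ ∀ r R : ℝ, 1 ≤ r → r < R →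
    proximity g ⊤ r ≤ C * log (gauge f r R)

/-- Functions whose characteristic grows at most linearly in the gauge of `f`. -/
def IsControlled (f g : ℂ → ℂ) : Prop :=
  Meromorphic g ∧ ∃ C : ℝ, 0 ≤ C ∧ ∀ r R : ℝ, 1 ≤ r → r < R →
    characteristic g ⊤ r ≤ C * gauge f r R

variable {f g h : ℂ → ℂ}

theorem log_two_le_log_gauge {r R : ℝ} (hr : 1 ≤ r) (hR : r < R) : log 2 ≤ log (gauge f r R) :=
  log_le_log (by norm_num) (two_le_gauge hr hR)

theorem log_gauge_le_gauge {r R : ℝ} (hr : 1 ≤ r) (hR : r < R) :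
    log (gauge f r R) ≤ gauge f r R :=
  log_le_self (by linarith [two_le_gauge (f := f) hr hR])

/-- A constant is an error term. -/
theorem exists_const_le_mul_log_gauge (f : ℂ → ℂ) {c : ℝ} (hc : 0 ≤ c) :
    ∃ C : ℝ, 0 ≤ C ∧ ∀ r R : ℝ, 1 ≤ r → r < R → c ≤ C * log (gauge f r R) := by
  have hl2 : 0 < log 2 := log_pos (by norm_num)
  refine ⟨c / log 2, by positivity, fun r R hr hR ↦ ?_⟩
  rw [div_mul_eq_mul_div, le_div_iff₀ hl2]
  exact mul_le_mul_of_nonneg_left (log_two_le_log_gauge hr hR) hc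

theorem isSmall_const (f : ℂ → ℂ) (c : ℂ) : IsSmall f fun _ ↦ c := by
  obtain ⟨C, hC0, hC⟩ := exists_const_le_mul_log_gauge f (c := log⁺ ‖c‖) posLog_nonneg
  refine ⟨.const c, C, hC0, fun r R hr hR ↦ ?_⟩
  rw [proximity_const]
  exact hC r R hr hR

theorem IsSmall.mul (hg : IsSmall f g) (hh : IsSmall f h) : IsSmall f (g * h) := by
  obtain ⟨hgm, C, hC0, hC⟩ := hg
  obtain ⟨hhm, C', hC0', hC'⟩ := hh
  refine ⟨hgm.mul hhm, C + C', by positivity, fun r R hr hR ↦ ?_⟩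
  have := proximity_mul_top_le hgm hhm r
  rw [Pi.add_apply] at this
  linarith [hC r R hr hR, hC' r R hr hR]

theorem IsSmall.pow (hg : IsSmall f g) (n : ℕ) : IsSmall f (g ^ n) := by
  obtain ⟨hgm, C, hC0, hC⟩ := hg
  refine ⟨hgm.pow, n * C, by positivity, fun r R hr hR ↦ ?_⟩
  rw [proximity_pow_top, Pi.smul_apply, nsmul_eq_mul, mul_assoc]
  exact mul_le_mul_of_nonneg_left (hC r R hr hR) (by positivity)

theorem IsSmall.prod {ι : Type*} {s : Finset ι} {G : ι → ℂ → ℂ} (hG : ∀ i ∈ s, IsSmall f (G i)) :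
    IsSmall f (∏ i ∈ s, G i) := by
  classical
  induction s using Finset.induction_on with
  | empty => exact isSmall_const f 1
  | insert i s his ih =>
    rw [Finset.prod_insert his]
    exact (hG i (by simp)).mul (ih fun j hj ↦ hG j (by simp [hj]))

theorem IsSmall.congr (hg : IsSmall f g) (hgh : g =ᶠ[codiscrete ℂ] h) : IsSmall f h := by
  obtain ⟨hgm, C, hC0, hC⟩ := hg
  refine ⟨hgm.congr_codiscrete hgh, C, hC0, fun r R hr hR ↦ ?_⟩
  rw [← proximity_congr_codiscrete hgh (by linarith)]
  exact hC r R hr hR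

theorem isControlled_self (hf : Meromorphic f) : IsControlled f f := by
  refine ⟨hf, 1, zero_le_one, fun r R hr hR ↦ ?_⟩
  have h1 : characteristic f ⊤ r ≤ characteristic f ⊤ R :=
    characteristic_monotoneOn hf (by simp only [mem_Ioi]; linarith)
      (by simp only [mem_Ioi]; linarith) hR.le
  have h2 : 0 < 1 / (R - r) := one_div_pos.2 (by linarith)
  unfold gauge
  linarith

/-- The logarithmic derivative lemma for g has its error in the gauge of g. Evaluated at the
midpoint of r and R, that gauge is at most a constant multiple of the gauge of f, and the logarithm
turns the constant into an additive one. -/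
theorem IsControlled.isSmall_logDeriv (hg : IsControlled f g)
    (htop : ∀ z, meromorphicOrderAt g z ≠ ⊤) : IsSmall f (logDeriv g) := by
  obtain ⟨hgm, C, hC0, hC⟩ := hg
  obtain ⟨C', hC0', hC'⟩ := exists_proximity_logDeriv_le hgm htop
  obtain ⟨K, hK0, hK⟩ := exists_const_le_mul_log_gauge f (c := log (2 * C + 2))
    (log_nonneg (by linarith))
  refine ⟨hgm.logDeriv, C' * (K + 1), by positivity, fun r R hr hR ↦ ?_⟩
  set m := (r + R) / 2 with hm
  have hrm : r < m := by simp only [hm]; linarith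
  have hmR : m < R := by simp only [hm]; linarith
  have hX := two_le_gauge (f := f) hr hR
  have hgm2 := two_le_gauge (f := g) hr hrm
  have h1 : 1 / (R - m) = 2 * (1 / (R - r)) := by
    rw [show R - m = (R - r) / 2 by simp only [hm]; ring]
    field_simp
  have h2 : 1 / (m - r) = 2 * (1 / (R - r)) := by
    rw [show m - r = (R - r) / 2 by simp only [hm]; ring]
    field_simp
  have h3 : gauge g r m ≤ (2 * C + 2) * gauge f r R := by
    have hT0 := characteristic_nonneg (f := f) (a := ⊤) (show 1 ≤ R by linarith)
    have h4 := hC m R (by linarith) hmR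
    have hfm : gauge f m R ≤ 2 * gauge f r R := by
      unfold gauge
      rw [h1]
      linarith
    have h5 : C * gauge f m R ≤ C * (2 * gauge f r R) := mul_le_mul_of_nonneg_left hfm hC0
    have h6 : 2 + m + 1 / (m - r) ≤ 2 * gauge f r R := by
      unfold gauge
      rw [h2]
      linarith
    have h7 : gauge g r m = characteristic g ⊤ m + (2 + m + 1 / (m - r)) := by
      unfold gauge
      ring
    linarith
  have h4 : log (gauge g r m) ≤ (K + 1) * log (gauge f r R) := by
    have h5 := log_le_log (by linarith) h3
    rw [log_mul (by linarith) (by linarith)] at h5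
    linarith [hK r R hr hR]
  refine (hC' r m hr hrm).trans ?_
  rw [mul_assoc]
  exact mul_le_mul_of_nonneg_left h4 hC0'

theorem deriv_eventuallyEq_mul_logDeriv (hg : Meromorphic g)
    (htop : ∀ z, meromorphicOrderAt g z ≠ ⊤) : deriv g =ᶠ[codiscrete ℂ] g * logDeriv g := by
  filter_upwards [hg.meromorphicOn.eventually_codiscreteWithin_apply_ne_zero (U := univ)
    fun z _ ↦ htop z] with z hz
  rw [Pi.mul_apply, logDeriv_apply, mul_div_cancel₀ _ hz]

/-- Write g' = g · (g'/g) for the proximity function, and use N(r, g') ≤ 2 N(r, g) for the poles. -/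
theorem IsControlled.deriv (hg : IsControlled f g) (htop : ∀ z, meromorphicOrderAt g z ≠ ⊤) :
    IsControlled f (deriv g) := by
  obtain ⟨hlm, C', hC0', hC'⟩ := hg.isSmall_logDeriv htop
  obtain ⟨hgm, C, hC0, hC⟩ := hg
  refine ⟨hgm.deriv, 2 * C + C', by positivity, fun r R hr hR ↦ ?_⟩
  have h1 := proximity_mul_top_le hgm hlm r
  rw [Pi.add_apply] at h1
  have h2 : ValueDistribution.logCounting (_root_.deriv g) ⊤ r ≤
      2 * ValueDistribution.logCounting g ⊤ r := by
    have := logCounting_le (negPart_divisor_deriv_le hgm) hr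
    rw [map_nsmul, Pi.smul_apply, nsmul_eq_mul] at this
    simpa only [ValueDistribution.logCounting_top, Nat.cast_ofNat] using this
  have h3 : characteristic (_root_.deriv g) ⊤ r = proximity (g * logDeriv g) ⊤ r +
      ValueDistribution.logCounting (_root_.deriv g) ⊤ r := by
    rw [characteristic, Pi.add_apply,
      proximity_congr_codiscrete (deriv_eventuallyEq_mul_logDeriv hgm htop) (by linarith)]
  have h4 : characteristic g ⊤ r = proximity g ⊤ r + ValueDistribution.logCounting g ⊤ r := rfl
  have h5 : 0 ≤ proximity g ⊤ r := proximity_nonneg r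
  have h6 := mul_le_mul_of_nonneg_left (log_gauge_le_gauge (f := f) hr hR) hC0'
  linarith [hC r R hr hR, hC' r R hr hR]

theorem IsControlled.mul (hg : IsControlled f g) (hh : IsControlled f h)
    (hgtop : ∀ z, meromorphicOrderAt g z ≠ ⊤) (hhtop : ∀ z, meromorphicOrderAt h z ≠ ⊤) :
    IsControlled f (g * h) := by
  obtain ⟨hgm, C, hC0, hC⟩ := hg
  obtain ⟨hhm, C', hC0', hC'⟩ := hh
  refine ⟨hgm.mul hhm, C + C', by positivity, fun r R hr hR ↦ ?_⟩
  have := characteristic_mul_top_le hr hgm hgtop hhm hhtop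
  rw [Pi.add_apply] at this
  linarith [hC r R hr hR, hC' r R hr hR]

theorem IsControlled.pow (hg : IsControlled f g) (n : ℕ) : IsControlled f (g ^ n) := by
  obtain ⟨hgm, C, hC0, hC⟩ := hg
  refine ⟨hgm.pow, n * C, by positivity, fun r R hr hR ↦ ?_⟩
  rw [characteristic_pow_top hgm, Pi.smul_apply, nsmul_eq_mul, mul_assoc]
  exact mul_le_mul_of_nonneg_left (hC r R hr hR) (by positivity)

theorem meromorphicOrderAt_pow_ne_top {z : ℂ} (hg : MeromorphicAt g z)
    (htop : meromorphicOrderAt g z ≠ ⊤) (n : ℕ) : meromorphicOrderAt (g ^ n) z ≠ ⊤ := by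
  rw [meromorphicOrderAt_ne_top_iff_eventually_ne_zero hg] at htop
  rw [meromorphicOrderAt_ne_top_iff_eventually_ne_zero (hg.pow n)]
  filter_upwards [htop] with w hw
  exact pow_ne_zero n hw

theorem meromorphicOrderAt_prod_ne_top {ι : Type*} {s : Finset ι} {G : ι → ℂ → ℂ} {z : ℂ}
    (hG : ∀ i ∈ s, MeromorphicAt (G i) z) (htop : ∀ i ∈ s, meromorphicOrderAt (G i) z ≠ ⊤) :
    meromorphicOrderAt (∏ i ∈ s, G i) z ≠ ⊤ := by
  rw [meromorphicOrderAt_ne_top_iff_eventually_ne_zero (MeromorphicAt.prod hG)]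
  have : ∀ᶠ w in 𝓝[≠] z, ∀ i ∈ s, G i w ≠ 0 := (eventually_all_finset s).2 fun i hi ↦
    (meromorphicOrderAt_ne_top_iff_eventually_ne_zero (hG i hi)).1 (htop i hi)
  filter_upwards [this] with w hw
  rw [Finset.prod_apply]
  exact Finset.prod_ne_zero_iff.2 hw

theorem IsControlled.prod {ι : Type*} {s : Finset ι} {G : ι → ℂ → ℂ}
    (hG : ∀ i ∈ s, IsControlled f (G i))
    (htop : ∀ i ∈ s, ∀ z, meromorphicOrderAt (G i) z ≠ ⊤) :
    IsControlled f (∏ i ∈ s, G i) := by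
  classical
  induction s using Finset.induction_on with
  | empty =>
    refine ⟨.const 1, 1, zero_le_one, fun r R hr hR ↦ ?_⟩
    have h1 : characteristic (fun _ : ℂ ↦ (1 : ℂ)) ⊤ r = 0 := by
      simp [characteristic]
    have h2 := two_le_gauge (f := f) hr hR
    change characteristic (fun _ : ℂ ↦ (1 : ℂ)) ⊤ r ≤ _
    rw [h1]
    linarith
  | insert i s his ih =>
    rw [Finset.prod_insert his]
    refine (hG i (by simp)).mul (ih (fun j hj ↦ hG j (by simp [hj]))
      fun j hj ↦ htop j (by simp [hj])) (htop i (by simp)) fun z ↦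
        meromorphicOrderAt_prod_ne_top (fun j hj ↦ (hG j (by simp [hj])).1 z)
          fun j hj ↦ htop j (by simp [hj]) z

theorem IsControlled.sub_const (hg : IsControlled f g) (a : ℂ) :
    IsControlled f fun z ↦ g z - a := by
  obtain ⟨hgm, C, hC0, hC⟩ := hg
  obtain ⟨K, hK0, hK⟩ := exists_const_le_mul_log_gauge f (c := log⁺ ‖a‖ + log 2)
    (add_nonneg posLog_nonneg (log_nonneg (by norm_num)))
  refine ⟨fun z ↦ (hgm z).sub (.const a z), C + K, by positivity, fun r R hr hR ↦ ?_⟩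
  have h1 := abs_le.1 (abs_characteristic_sub_characteristic_shift_le (a₀ := a) (r := r) hgm)
  have h2 := mul_le_mul_of_nonneg_left (log_gauge_le_gauge (f := f) hr hR) hK0
  linarith [hC r R hr hR, hK r R hr hR]

theorem isControlled_iteratedDeriv (hf : Meromorphic f)
    (htop : ∀ i z, meromorphicOrderAt (iteratedDeriv i f) z ≠ ⊤) (i : ℕ) :
    IsControlled f (iteratedDeriv i f) := by
  induction i with
  | zero => simpa using isControlled_self hf
  | succ i ih => rw [iteratedDeriv_succ]; exact ih.deriv (htop i)

theorem isSmall_iteratedDeriv_div (hf : Meromorphic f)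
    (htop : ∀ i z, meromorphicOrderAt (iteratedDeriv i f) z ≠ ⊤) (i : ℕ) :
    IsSmall f (iteratedDeriv i f / f) := by
  induction i with
  | zero =>
    apply (isSmall_const f 1).congr
    filter_upwards [hf.meromorphicOn.eventually_codiscreteWithin_apply_ne_zero (U := univ)
      fun z _ ↦ by simpa using htop 0 z] with z hz
    simp [hz]
  | succ i ih =>
    have hm := meromorphic_iteratedDeriv hf i
    -- The quotient telescopes into logarithmic derivatives of successive derivatives.
    apply (((isControlled_iteratedDeriv hf htop i).isSmall_logDeriv (htop i)).mul ih).congr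
    filter_upwards [deriv_eventuallyEq_mul_logDeriv hm (htop i)] with z hz
    rw [iteratedDeriv_succ, Pi.div_apply, hz]
    simp only [Pi.mul_apply, Pi.div_apply]
    ring

end

section

/-! ### Growth of the characteristic of a transcendental function -/

/-- N points of the support with N > C already contribute N log r - O(1), which eventually exceeds C
log r. -/
theorem finite_support_of_frequently_logCounting_le {D : Function.locallyFinsupp ℂ ℤ} (hD : 0 ≤ D)
    {C : ℝ} (h : ∃ᶠ r in atTop, logCounting D r ≤ C * log r) : D.support.Finite := by
  classical
  obtain ⟨N, hN⟩ := exists_nat_gt C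
  by_contra hInf
  obtain ⟨t, htsub, htcard⟩ := Set.Infinite.exists_subset_card_eq hInf N
  set D' : Function.locallyFinsupp ℂ ℤ := ∑ z ∈ t, single z (1 : ℤ) with hD'
  have hle : D' ≤ D := by
    intro w
    simp only [hD', coe_sum, Finset.sum_apply, single_apply, Finset.sum_ite_eq]
    have h0 : (0 : ℤ) ≤ D w := hD w
    split_ifs with hw
    · have h₁ : D w ≠ 0 := Function.mem_support.mp (htsub (Finset.mem_coe.2 hw))
      omega
    · exact h0
  obtain ⟨R₀, hR₀⟩ : ∃ R₀ : ℝ, ∀ z ∈ t, ‖z‖ ≤ R₀ := t.finite_toSet.isBounded.exists_norm_le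
  set K := ∑ z ∈ t, log ‖z‖ with hK
  have hEq : ∀ᶠ r in atTop, logCounting D' r = (N : ℝ) * log r - K := by
    filter_upwards [eventually_ge_atTop R₀] with r hr using calc
      logCounting D' r = ∑ c ∈ t, logCounting (single c 1) r := by simp [hD']
       _ = ∑ z ∈ t, (log r - log ‖z‖) := by
        congr! 1 with z hz
        simpa using logCounting_single_eq_log_sub_const (e := z) (n := 1) ((hR₀ z hz).trans hr)
       _ = (N : ℝ) * log r - K := by simp [Finset.sum_sub_distrib, hK, htcard]
  have hTendsto : Tendsto (fun r ↦ ((N : ℝ) - C) * log r) atTop atTop :=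
    tendsto_log_atTop.const_mul_atTop (sub_pos.mpr hN)
  obtain ⟨r, hr, hr1, hr2, hr3⟩ := (h.and_eventually (hEq.and ((eventually_ge_atTop (1 : ℝ)).and
    (hTendsto.eventually_gt_atTop K)))).exists
  have := logCounting_le hle hr2
  linarith

theorem exists_rational_of_finite_support {d : ℂ → ℤ} (hd : d.support.Finite) (c : ℂ) :
    ∃ P Q : Polynomial ℂ, Q ≠ 0 ∧
      ∀ᶠ z in codiscrete ℂ, (∏ᶠ u, (· - u) ^ d u : ℂ → ℂ) z * c = P.eval z / Q.eval z := by
  classical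
  refine ⟨(∏ u ∈ hd.toFinset, (Polynomial.X - Polynomial.C u) ^ (d u).toNat) * Polynomial.C c,
    ∏ u ∈ hd.toFinset, (Polynomial.X - Polynomial.C u) ^ (-d u).toNat, ?_, ?_⟩
  · exact Finset.prod_ne_zero_iff.2 fun u _ ↦ pow_ne_zero _ (Polynomial.X_sub_C_ne_zero u)
  · have hfin : (hd.toFinset : Set ℂ)ᶜ ∈ codiscrete ℂ := hd.toFinset.finite_toSet.compl_mem_codiscrete
    filter_upwards [hfin] with z hz
    rw [finprod_eq_prod_of_mulSupport_subset (s := hd.toFinset) _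
      (by simp [Function.FactorizedRational.mulSupport]), Finset.prod_apply]
    simp only [Polynomial.eval_mul, Polynomial.eval_prod, Polynomial.eval_pow, Polynomial.eval_sub,
      Polynomial.eval_X, Polynomial.eval_C, Pi.pow_apply]
    rw [mul_div_right_comm, ← Finset.prod_div_distrib]
    congr 1
    apply Finset.prod_congr rfl
    intro u hu
    have hzu : z - u ≠ 0 := by
      rw [sub_ne_zero]
      rintro rfl
      exact hz (Finset.mem_coe.2 hu)
    rw [← zpow_natCast, ← zpow_natCast, ← zpow_sub₀ hzu]
    congr 1
    omega

variable {f : ℂ → ℂ}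

theorem eventuallyEq_zero_of_meromorphicOrderAt_eq_top {g : ℂ → ℂ}
    (h : ∀ z, meromorphicOrderAt g z = ⊤) : g =ᶠ[codiscrete ℂ] 0 := by
  rw [EventuallyEq, Filter.Eventually, codiscrete, mem_codiscreteWithin_iff_forall_mem_nhdsNE]
  intro z _
  filter_upwards [meromorphicOrderAt_eq_top_iff.1 (h z)] with w hw
  exact Or.inl hw

theorem meromorphicOrderAt_ne_top_of_transcendental
    (hf : DiffMonomial.IsTranscendentalMeromorphic f) (z : ℂ) : meromorphicOrderAt f z ≠ ⊤ := by
  refine hf.1.exists_meromorphicOrderAt_ne_top_iff_forall.1 ?_ z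
  by_contra! hall
  apply hf.2
  refine ⟨0, 1, one_ne_zero, ?_⟩
  filter_upwards [eventuallyEq_zero_of_meromorphicOrderAt_eq_top hall] with z hz
  simpa using hz

/-- A Liouville argument: at a fixed z, the Poisson bound on g'/g is O((log ρ)/ρ) along an unbounded
set of radii. -/
theorem exists_eq_const_of_frequently_le {g : ℂ → ℂ} (hg : AnalyticOnNhd ℂ g univ)
    (hg0 : ∀ z, g z ≠ 0) {a b : ℝ}
    (h : ∃ᶠ ρ in atTop, circleAverage (fun z ↦ |log ‖g z‖|) 0 ρ ≤ a * log ρ + b) :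
    ∃ c, ∀ z, g z = c := by
  have hderiv : ∀ z, deriv g z = 0 := by
    intro z
    have hlim : Tendsto (fun ρ : ℝ ↦ 8 * (a * (log ρ / ρ) + b * ρ⁻¹)) atTop (𝓝 0) := by
      have h1 : Tendsto (fun ρ : ℝ ↦ log ρ / ρ) atTop (𝓝 0) :=
        isLittleO_log_id_atTop.tendsto_div_nhds_zero
      have h2 : Tendsto (fun ρ : ℝ ↦ ρ⁻¹) atTop (𝓝 0) := tendsto_inv_atTop_zero
      simpa using ((h1.const_mul a).add (h2.const_mul b)).const_mul 8
    have hle : ‖logDeriv g z‖ ≤ 0 := by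
      by_contra! hpos
      obtain ⟨ρ, hρ, hρ1, hρ2, hρ3⟩ := (h.and_eventually ((hlim.eventually_lt_const hpos).and
        ((eventually_gt_atTop (2 * ‖z‖)).and (eventually_ge_atTop 1)))).exists
      have hρ0 : 0 < ρ := by linarith
      have h1 := norm_logDeriv_le (ρ := ρ) (w := z) (fun w _ ↦ hg w (mem_univ w)) (fun w _ ↦ hg0 w)
        (by simp; linarith [norm_nonneg z])
      have h2 : 2 * ρ / (ρ - ‖z‖) ^ 2 ≤ 8 / ρ := by
        rw [div_le_div_iff₀ (by nlinarith [norm_nonneg z]) hρ0]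
        nlinarith [norm_nonneg z]
      have h3 : 0 ≤ circleAverage (fun z ↦ |log ‖g z‖|) 0 ρ :=
        circleAverage_nonneg_of_nonneg fun z _ ↦ abs_nonneg _
      have h4 : ‖logDeriv g z‖ ≤ 8 / ρ * (a * log ρ + b) :=
        h1.trans (mul_le_mul h2 hρ h3 (by positivity))
      have h5 : 8 / ρ * (a * log ρ + b) = 8 * (a * (log ρ / ρ) + b * ρ⁻¹) := by
        field_simp
      linarith
    have := norm_le_zero_iff.1 hle
    rw [logDeriv_apply, div_eq_zero_iff] at this
    exact this.resolve_right (hg0 z)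
  exact ⟨g 0, fun z ↦ is_const_of_deriv_eq_zero
    (fun w ↦ (hg w (mem_univ w)).differentiableAt) hderiv z 0⟩

/-- The characteristic of a transcendental function grows faster than every multiple of `log r`. -/
theorem eventually_mul_log_le_characteristic (hf : DiffMonomial.IsTranscendentalMeromorphic f)
    (K : ℝ) : ∀ᶠ r in atTop, K * log r ≤ characteristic f ⊤ r := by
  by_contra hcon
  -- Logarithmic growth along an unbounded set of radii leaves finitely many zeros and poles. After
  -- removing them, a zero-free entire factor with O(log ρ) mean of |log ‖g‖| remains. It is
  -- constant, so f is rational.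
  have hfreq : ∃ᶠ r in atTop, characteristic f ⊤ r ≤ K * log r := by
    rw [not_eventually] at hcon
    exact hcon.mono fun r hr ↦ (not_le.1 hr).le
  have hm := hf.1
  obtain ⟨A, hA0, hA⟩ := characteristic_inv_le hm
  set D := MeromorphicOn.divisor f univ with hD
  have hlog : ∀ᶠ r : ℝ in atTop, A ≤ log r := tendsto_log_atTop.eventually_ge_atTop A
  have hneg : (D⁻).support.Finite := by
    apply finite_support_of_frequently_logCounting_le (negPart_nonneg _) (C := K)
    refine hfreq.mono fun r hr ↦ le_trans ?_ hr
    rw [hD, ← ValueDistribution.logCounting_top]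
    exact logCounting_le_characteristic
  have hpos : (D⁺).support.Finite := by
    apply finite_support_of_frequently_logCounting_le (posPart_nonneg _) (C := K + 1)
    refine (hfreq.and_eventually hlog).mono fun r hr ↦ ?_
    have h1 := (abs_le.1 (hA r)).1
    have h2 := logCounting_le_characteristic (f := f⁻¹) (r := r)
    rw [ValueDistribution.logCounting_inv, ValueDistribution.logCounting_zero] at h2
    linarith [hr.1, hr.2]
  have hfin : D.support.Finite := by
    apply (hneg.union hpos).subset
    intro u hu
    by_contra hu'
    simp only [mem_union, Function.mem_support, not_or, not_not, negPart_apply, posPart_apply] at hu'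
    apply hu
    rw [← posPart_sub_negPart (D u), hu'.1, hu'.2, sub_zero]
  have htop := meromorphicOrderAt_ne_top_of_transcendental hf
  obtain ⟨g, hg, hg0, hfg⟩ := (hm.meromorphicOn (s := univ)).extract_zeros_poles
    (fun u ↦ htop u) hfin
  obtain ⟨R₀, hR₀⟩ : ∃ R₀ : ℝ, ∀ z ∈ D.support, ‖z‖ ≤ R₀ := hfin.isBounded.exists_norm_le
  set n := ∑ u ∈ hfin.toFinset, |(D u : ℝ)| with hn
  obtain ⟨c, hc⟩ := exists_eq_const_of_frequently_le (a := 2 * K + 2 * n) (b := A + 2 * n * log 2)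
    hg (fun z ↦ hg0 ⟨z, mem_univ z⟩) (by
      refine (hfreq.and_eventually ((eventually_ge_atTop 1).and (eventually_ge_atTop R₀))).mono ?_
      rintro ρ ⟨hρ, hρ1, hρ2⟩
      have h1 := circleAverage_abs_log_norm_le hm hρ1 (subset_univ _) hfin
        (fun u hu ↦ (hR₀ u hu).trans hρ2) hg0 hfg
      have h2 := proximity_le_characteristic (f := f) hρ1
      have h3 := proximity_le_characteristic (f := f⁻¹) hρ1
      have h4 := (abs_le.1 (hA ρ)).1
      rw [log_mul (by norm_num) (by linarith)] at h1
      rw [← hn] at h1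
      linarith)
  obtain ⟨P, Q, hQ, hPQ⟩ := exists_rational_of_finite_support hfin c
  refine hf.2 ⟨P, Q, hQ, ?_⟩
  filter_upwards [hfg, hPQ] with z hz hz'
  rw [hz, ← hz', Pi.smul_apply', hc, smul_eq_mul]

theorem tendsto_characteristic_atTop (hf : DiffMonomial.IsTranscendentalMeromorphic f) :
    Tendsto (characteristic f ⊤) atTop atTop := by
  apply tendsto_atTop_mono' _ _ tendsto_log_atTop
  filter_upwards [eventually_mul_log_le_characteristic hf 1] with r hr
  linarith

/-- Borel's growth lemma. -/
theorem exists_ge_le_two_mul {T : ℝ → ℝ} (hT : MonotoneOn T (Ioi 0)) (hlim : Tendsto T atTop atTop)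
    (r₀ : ℝ) : ∃ r ≥ r₀, T (r + 1 / T r) ≤ 2 * T r := by
  by_contra! hcon
  obtain ⟨r₁, h0, h1, h2⟩ := ((eventually_ge_atTop r₀).and ((eventually_ge_atTop 1).and
    (hlim.eventually_ge_atTop 1))).exists
  -- If the inequality always failed, T would more than double at each step. The steps 1/T(xₙ) ≤ 2⁻ⁿ
  -- sum to at most 2, so T would be unbounded on [r₁, r₁ + 2], against monotonicity.
  let x : ℕ → ℝ := fun n ↦ Nat.rec r₁ (fun _ y ↦ y + 1 / T y) n
  have hx : ∀ n, x (n + 1) = x n + 1 / T (x n) := fun n ↦ rfl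
  have key : ∀ n, r₁ ≤ x n ∧ 2 ^ n ≤ T (x n) ∧ x n ≤ r₁ + 2 - 2 * (1 / 2) ^ n := by
    intro n
    induction n with
    | zero => exact ⟨le_rfl, by rw [pow_zero]; exact h2, by simp [x]⟩
    | succ n ih =>
      obtain ⟨ih1, ih2, ih3⟩ := ih
      have hpos : (0 : ℝ) < 2 ^ n := by positivity
      have h3 : 1 / T (x n) ≤ (1 / 2) ^ n := by
        rw [one_div_pow]
        exact one_div_le_one_div_of_le hpos ih2
      have h4 : 0 < 1 / T (x n) := one_div_pos.2 (hpos.trans_le ih2)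
      have h5 := hcon (x n) (h0.trans ih1)
      rw [← hx] at h5
      refine ⟨by rw [hx]; linarith, by rw [pow_succ]; linarith, ?_⟩
      rw [hx, pow_succ]
      linarith
  obtain ⟨n, hn⟩ := pow_unbounded_of_one_lt (T (r₁ + 2)) (one_lt_two (α := ℝ))
  obtain ⟨k1, k2, k3⟩ := key n
  have : T (x n) ≤ T (r₁ + 2) := by
    have : (0 : ℝ) < (1 / 2) ^ n := by positivity
    exact hT (show 0 < x n by linarith) (show 0 < r₁ + 2 by linarith) (by linarith)
  linarith

/-- Along arbitrarily large radii, error terms are negligible against the characteristic. -/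
theorem frequently_log_gauge_le (hf : DiffMonomial.IsTranscendentalMeromorphic f) {ε : ℝ}
    (hε : 0 < ε) :
    ∃ᶠ r in atTop, log (gauge f r (r + 1 / characteristic f ⊤ r)) ≤ ε * characteristic f ⊤ r := by
  set T := characteristic f ⊤ with hT
  have hlim : Tendsto T atTop atTop := tendsto_characteristic_atTop hf
  have h1 : ∃ᶠ r in atTop, T (r + 1 / T r) ≤ 2 * T r :=
    frequently_atTop.2 fun r₀ ↦ exists_ge_le_two_mul (characteristic_monotoneOn hf.1) hlim r₀
  have h2 : ∀ᶠ r in atTop, log (T r) ≤ ε / 3 * T r := by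
    have := hlim.eventually (isLittleO_log_id_atTop.bound (show 0 < ε / 3 by positivity))
    filter_upwards [this, hlim.eventually_ge_atTop 0] with r hr hr0
    rw [id, norm_of_nonneg hr0] at hr
    exact (le_abs_self _).trans hr
  have h3 : ∀ᶠ r in atTop, log r ≤ ε / 3 * T r := by
    filter_upwards [eventually_mul_log_le_characteristic hf (3 / ε)] with r hr
    calc log r = ε / 3 * (3 / ε * log r) := by field_simp
      _ ≤ _ := by gcongr
  have h4 : ∀ᶠ r in atTop, log 7 ≤ ε / 3 * T r :=
    (hlim.const_mul_atTop (show 0 < ε / 3 by positivity)).eventually_ge_atTop _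
  refine (h1.and_eventually (h2.and (h3.and (h4.and ((hlim.eventually_ge_atTop 1).and
    (eventually_ge_atTop 1)))))).mono ?_
  rintro r ⟨k1, k2, k3, k4, k5, k6⟩
  have hinv : 1 / T r ≤ 1 := by
    rw [div_le_one (by linarith)]
    exact k5
  have hinv0 : 0 < 1 / T r := one_div_pos.2 (by linarith)
  -- For R = r + 1/T(r), the term 1/(R - r) equals T(r) and T(R) ≤ 2 T(r). The gauge is thus at most
  -- 3 + 3 T(r) + r.
  have hg : gauge f r (r + 1 / T r) ≤ 7 * T r * r := by
    have h5 : 1 / (r + 1 / T r - r) = T r := by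
      rw [add_sub_cancel_left, one_div_one_div]
    rw [gauge, h5, ← hT]
    nlinarith [mul_nonneg (sub_nonneg.2 k5) (sub_nonneg.2 k6)]
  have h6 := two_le_gauge (f := f) k6 (show r < r + 1 / T r by linarith)
  have h7 := log_le_log (by linarith) hg
  rw [log_mul (by positivity) (by positivity), log_mul (by norm_num) (by positivity)] at h7
  linarith

end

section

/-! ### Functions with vanishing derivative -/

theorem eventually_nhdsNE_of_codiscrete {p : ℂ → Prop} (h : ∀ᶠ z in codiscrete ℂ, p z) (z : ℂ) :
    ∀ᶠ w in 𝓝[≠] z, p w := by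
  rw [Filter.Eventually, codiscrete, mem_codiscreteWithin_iff_forall_mem_nhdsNE] at h
  have := h z (mem_univ z)
  rwa [compl_univ, union_empty] at this

theorem exists_eventuallyEq_const {g : ℂ → ℂ} (hg : Meromorphic g)
    (h : ∀ z, meromorphicOrderAt (deriv g) z = ⊤) : ∃ c : ℂ, g =ᶠ[codiscrete ℂ] fun _ ↦ c := by
  -- The divisor has the default value 0 where the order is ⊤. A pole of g would force a negative
  -- value for g', so g has no poles and its normal form is entire.
  have hdiv : 0 ≤ MeromorphicOn.divisor g univ := by
    intro z
    by_contra hz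
    have hz' : MeromorphicOn.divisor g univ z < 0 := not_le.1 hz
    have h1 := divisor_deriv_eq_sub_one hg hz'.ne
    rw [divisor_apply_of_meromorphic hg.deriv, h z] at h1
    simp only [WithTop.untop₀_top] at h1
    omega
  set G := toMeromorphicNFOn g univ with hG
  have hgG : g =ᶠ[codiscrete ℂ] G := toMeromorphicNFOn_eqOn_codiscrete hg.meromorphicOn
  have hNF : MeromorphicNFOn G univ := meromorphicNFOn_toMeromorphicNFOn g univ
  have hGan : AnalyticOnNhd ℂ G univ := by
    rw [← hNF.divisor_nonneg_iff_analyticOnNhd, hG,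
      MeromorphicOn.divisor_of_toMeromorphicNFOn hg.meromorphicOn]
    exact hdiv
  have hd : deriv g =ᶠ[codiscrete ℂ] deriv G :=
    hg.meromorphicOn.deriv_eventuallyEq_codiscreteWithin hNF.meromorphicOn hgG
  have hzero : ∀ z, deriv G z = 0 := by
    intro z
    have h1 : deriv G =ᶠ[𝓝[≠] z] 0 := by
      filter_upwards [eventually_nhdsNE_of_codiscrete hd z,
        meromorphicOrderAt_eq_top_iff.1 (h z)] with w hw hw'
      rw [← hw, hw', Pi.zero_apply]
    have h2 : Tendsto (deriv G) (𝓝[≠] z) (𝓝 (deriv G z)) :=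
      (hGan.deriv z (mem_univ z)).continuousAt.tendsto.mono_left nhdsWithin_le_nhds
    exact tendsto_nhds_unique h2 (tendsto_const_nhds.congr' h1.symm)
  refine ⟨G 0, ?_⟩
  filter_upwards [hgG] with z hz
  rw [hz]
  exact is_const_of_deriv_eq_zero (fun w ↦ (hGan w (mem_univ w)).differentiableAt) hzero z 0

theorem exists_polynomial_derivative_eq (P : Polynomial ℂ) :
    ∃ A : Polynomial ℂ, Polynomial.derivative A = P := by
  induction P using Polynomial.induction_on' with
  | add P Q hP hQ =>
    obtain ⟨A, rfl⟩ := hP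
    obtain ⟨B, rfl⟩ := hQ
    exact ⟨A + B, Polynomial.derivative_add⟩
  | monomial n a =>
    refine ⟨Polynomial.monomial (n + 1) (a / (n + 1)), ?_⟩
    have : (n : ℂ) + 1 ≠ 0 := Nat.cast_add_one_ne_zero n
    rw [Polynomial.derivative_monomial, Nat.add_sub_cancel]
    push_cast
    rw [div_mul_cancel₀ _ this]

theorem exists_eventuallyEq_polynomial {g : ℂ → ℂ} (hg : Meromorphic g) {P : Polynomial ℂ}
    (h : deriv g =ᶠ[codiscrete ℂ] fun z ↦ P.eval z) :
    ∃ A : Polynomial ℂ, g =ᶠ[codiscrete ℂ] fun z ↦ A.eval z := by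
  obtain ⟨A, rfl⟩ := exists_polynomial_derivative_eq P
  have hA : Meromorphic fun z ↦ A.eval z := fun z ↦
    (A.differentiable.analyticAt z).meromorphicAt
  obtain ⟨c, hc⟩ := exists_eventuallyEq_const (hg.sub hA) (by
    intro z
    rw [meromorphicOrderAt_eq_top_iff]
    have h1 : ∀ᶠ w in 𝓝[≠] z, DifferentiableAt ℂ g w :=
      (hg z).eventually_analyticAt.mono fun w hw ↦ hw.differentiableAt
    filter_upwards [eventually_nhdsNE_of_codiscrete h z, h1] with w hw hw1
    rw [deriv_sub hw1 A.differentiableAt, hw, Polynomial.deriv, sub_self])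
  refine ⟨A + Polynomial.C c, ?_⟩
  filter_upwards [hc] with z hz
  rw [Pi.sub_apply] at hz
  rw [Polynomial.eval_add, Polynomial.eval_C, ← hz]
  ring

variable {f : ℂ → ℂ}

/-- Were some derivative identically zero, integrating back i times would make f a polynomial. -/
theorem meromorphicOrderAt_iteratedDeriv_ne_top (hf : DiffMonomial.IsTranscendentalMeromorphic f)
    (i : ℕ) (z : ℂ) : meromorphicOrderAt (iteratedDeriv i f) z ≠ ⊤ := by
  refine (meromorphic_iteratedDeriv hf.1 i).exists_meromorphicOrderAt_ne_top_iff_forall.1 ?_ z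
  by_contra! hall
  have key : ∀ j ≤ i, ∃ A : Polynomial ℂ,
      iteratedDeriv (i - j) f =ᶠ[codiscrete ℂ] fun z ↦ A.eval z := by
    intro j
    induction j with
    | zero =>
      refine fun _ ↦ ⟨0, ?_⟩
      filter_upwards [eventuallyEq_zero_of_meromorphicOrderAt_eq_top hall] with z hz
      simpa using hz
    | succ j ih =>
      intro hj
      obtain ⟨A, hA⟩ := ih (by omega)
      rw [show i - j = (i - (j + 1)) + 1 by omega, iteratedDeriv_succ] at hA
      exact exists_eventuallyEq_polynomial (meromorphic_iteratedDeriv hf.1 _) hA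
  obtain ⟨A, hA⟩ := key i le_rfl
  refine hf.2 ⟨A, 1, one_ne_zero, ?_⟩
  simpa using hA

/-! ### The differential monomial -/

variable {k : ℕ} {q : ℕ → ℕ}

theorem monomial_eq_prod (k : ℕ) (q : ℕ → ℕ) (f : ℂ → ℂ) :
    DiffMonomial.monomial k q f = ∏ i ∈ Finset.range (k + 1), iteratedDeriv i f ^ q i := by
  ext z
  simp [DiffMonomial.monomial]

theorem isControlled_monomial (hf : DiffMonomial.IsTranscendentalMeromorphic f) (k : ℕ)
    (q : ℕ → ℕ) : IsControlled f (DiffMonomial.monomial k q f) := by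
  rw [monomial_eq_prod]
  have htop := meromorphicOrderAt_iteratedDeriv_ne_top hf
  exact .prod (fun i _ ↦ (isControlled_iteratedDeriv hf.1 htop i).pow _) fun i _ z ↦
    meromorphicOrderAt_pow_ne_top (meromorphic_iteratedDeriv hf.1 i z) (htop i z) _

theorem meromorphicOrderAt_monomial_ne_top (hf : DiffMonomial.IsTranscendentalMeromorphic f)
    (k : ℕ) (q : ℕ → ℕ) (z : ℂ) : meromorphicOrderAt (DiffMonomial.monomial k q f) z ≠ ⊤ := by
  rw [monomial_eq_prod]
  exact meromorphicOrderAt_prod_ne_top (fun i _ ↦ (meromorphic_iteratedDeriv hf.1 i z).pow _)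
    fun i _ ↦ meromorphicOrderAt_pow_ne_top (meromorphic_iteratedDeriv hf.1 i z)
      (meromorphicOrderAt_iteratedDeriv_ne_top hf i z) _

theorem divisor_monomial (hf : DiffMonomial.IsTranscendentalMeromorphic f) (k : ℕ) (q : ℕ → ℕ)
    (z : ℂ) : MeromorphicOn.divisor (DiffMonomial.monomial k q f) univ z =
      ∑ i ∈ Finset.range (k + 1), q i * MeromorphicOn.divisor (iteratedDeriv i f) univ z := by
  have hm := meromorphic_iteratedDeriv hf.1
  rw [monomial_eq_prod, MeromorphicOn.divisor_prod
    (fun i _ ↦ (hm i).pow.meromorphicOn) (fun i _ z _ ↦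
      meromorphicOrderAt_pow_ne_top (hm i z) (meromorphicOrderAt_iteratedDeriv_ne_top hf i z) _)]
  simp [coe_sum, Finset.sum_apply, MeromorphicOn.divisor_pow (hm _).meromorphicOn]

theorem divisor_monomial_of_neg (hf : DiffMonomial.IsTranscendentalMeromorphic f) {z : ℂ}
    (h : MeromorphicOn.divisor f univ z < 0) :
    MeromorphicOn.divisor (DiffMonomial.monomial k q f) univ z =
      DiffMonomial.mu k q * MeromorphicOn.divisor f univ z - DiffMonomial.muStar k q := by
  rw [divisor_monomial hf, DiffMonomial.mu, DiffMonomial.muStar]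
  push_cast
  rw [Finset.sum_mul, ← Finset.sum_sub_distrib]
  refine Finset.sum_congr rfl fun i _ ↦ ?_
  rw [divisor_iteratedDeriv_of_neg hf.1 h]
  ring

theorem le_divisor_monomial (hf : DiffMonomial.IsTranscendentalMeromorphic f) (z : ℂ) :
    DiffMonomial.mu k q * MeromorphicOn.divisor f univ z - DiffMonomial.muStar k q ≤
      MeromorphicOn.divisor (DiffMonomial.monomial k q f) univ z := by
  rw [divisor_monomial hf, DiffMonomial.mu, DiffMonomial.muStar]
  push_cast
  rw [Finset.sum_mul, ← Finset.sum_sub_distrib]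
  refine Finset.sum_le_sum fun i _ ↦ ?_
  calc _ = (q i : ℤ) * (MeromorphicOn.divisor f univ z - i) := by ring
    _ ≤ _ := mul_le_mul_of_nonneg_left (divisor_sub_le_divisor_iteratedDeriv hf.1 z i)
      (Int.natCast_nonneg _)

theorem mul_le_divisor_monomial (hf : DiffMonomial.IsTranscendentalMeromorphic f) {z : ℂ}
    (h : 0 ≤ MeromorphicOn.divisor f univ z) :
    q 0 * MeromorphicOn.divisor f univ z ≤
      MeromorphicOn.divisor (DiffMonomial.monomial k q f) univ z := by
  rw [divisor_monomial hf, Finset.sum_range_succ', iteratedDeriv_zero]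
  exact le_add_of_nonneg_left (Finset.sum_nonneg fun i _ ↦
    mul_nonneg (Int.natCast_nonneg _) (divisor_iteratedDeriv_nonneg hf.1 h _))

theorem isSmall_monomial_div_pow (hf : DiffMonomial.IsTranscendentalMeromorphic f) (k : ℕ)
    (q : ℕ → ℕ) : IsSmall f (DiffMonomial.monomial k q f / f ^ DiffMonomial.mu k q) := by
  have h : ∏ i ∈ Finset.range (k + 1), (iteratedDeriv i f / f) ^ q i =
      DiffMonomial.monomial k q f / f ^ DiffMonomial.mu k q := by
    simp_rw [div_pow, Finset.prod_div_distrib]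
    rw [monomial_eq_prod, DiffMonomial.mu, Finset.prod_pow_eq_pow_sum]
  rw [← h]
  exact .prod fun i _ ↦ (isSmall_iteratedDeriv_div hf.1
    (meromorphicOrderAt_iteratedDeriv_ne_top hf) i).pow _

/-- A transcendental function without zeros does not have a small power of its inverse. -/
theorem not_isSmall_inv_pow (hf : DiffMonomial.IsTranscendentalMeromorphic f) {n : ℕ} (hn : n ≠ 0)
    (h : IsSmall f ((f ^ n)⁻¹)) (hD : ∀ z, MeromorphicOn.divisor f univ z ≤ 0) : False := by
  obtain ⟨_, C, hC0, hC⟩ := h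
  obtain ⟨A, hA0, hA⟩ := characteristic_inv_le hf.1
  have hpos : (MeromorphicOn.divisor f univ)⁺ = 0 := by
    ext z
    simpa [posPart_apply] using hD z
  have hlim := tendsto_characteristic_atTop hf
  -- With no zeros, T(r, 1/f) = m(r, 1/f). This ε makes that at most T(r, f)/2, while T(r, 1/f) ≥
  -- T(r, f) - A with A < T(r, f)/2.
  obtain ⟨r, h1, h2, h3⟩ := ((frequently_log_gauge_le hf (ε := 1 / (2 * (C + 1)))
    (by positivity)).and_eventually ((eventually_ge_atTop 1).and
      (hlim.eventually_gt_atTop (2 * A)))).exists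
  have h4 := hC r _ h2 (show r < r + 1 / characteristic f ⊤ r by
    have : 0 < 1 / characteristic f ⊤ r := one_div_pos.2 (by linarith)
    linarith)
  rw [← inv_pow, proximity_pow_top, Pi.smul_apply, nsmul_eq_mul] at h4
  have h5 : characteristic f⁻¹ ⊤ r = proximity f⁻¹ ⊤ r := by
    have : ValueDistribution.logCounting f⁻¹ ⊤ r = 0 := by
      rw [ValueDistribution.logCounting_inv, ValueDistribution.logCounting_zero, hpos]
      simp
    rw [characteristic, Pi.add_apply, this, add_zero]
  have h6 := (abs_le.1 (hA r)).2
  have h7 : proximity f⁻¹ ⊤ r ≤ n * proximity f⁻¹ ⊤ r :=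
    le_mul_of_one_le_left (proximity_nonneg r) (by exact_mod_cast Nat.one_le_iff_ne_zero.2 hn)
  have h8 : C * log (gauge f r (r + 1 / characteristic f ⊤ r)) ≤
      C * (1 / (2 * (C + 1)) * characteristic f ⊤ r) := mul_le_mul_of_nonneg_left h1 hC0
  have h9 : C * (1 / (2 * (C + 1)) * characteristic f ⊤ r) ≤ 1 / 2 * characteristic f ⊤ r := by
    rw [← mul_assoc]
    refine mul_le_mul_of_nonneg_right ?_ (by linarith)
    rw [mul_one_div, div_le_div_iff₀ (by positivity) (by norm_num)]
    linarith
  linarith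

/-- If ψ were a constant c, it would be nonzero, and q₀ ≥ 1 would exclude zeros of f. But then 1/f^μ
= c⁻¹ ψ/f^μ would be an error term, which is impossible. -/
theorem meromorphicOrderAt_deriv_monomial_ne_top
    (hf : DiffMonomial.IsTranscendentalMeromorphic f) (hq : 1 ≤ q 0) (z : ℂ) :
    meromorphicOrderAt (deriv (DiffMonomial.monomial k q f)) z ≠ ⊤ := by
  have hψ := (isControlled_monomial hf k q).1
  refine hψ.deriv.exists_meromorphicOrderAt_ne_top_iff_forall.1 ?_ z
  by_contra! hall
  obtain ⟨c, hc⟩ := exists_eventuallyEq_const hψ hall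
  have horder : ∀ z, meromorphicOrderAt (DiffMonomial.monomial k q f) z = if c = 0 then ⊤ else 0 := by
    intro z
    rw [meromorphicOrderAt_congr (eventually_nhdsNE_of_codiscrete hc z), meromorphicOrderAt_const]
  have hc0 : c ≠ 0 := by
    rintro rfl
    exact meromorphicOrderAt_monomial_ne_top hf k q 0 (by simpa using horder 0)
  refine not_isSmall_inv_pow hf (n := DiffMonomial.mu k q) ?_ ?_ ?_
  · rw [DiffMonomial.mu, Finset.sum_range_succ']
    omega
  · apply ((isSmall_const f c⁻¹).mul (isSmall_monomial_div_pow hf k q)).congr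
    filter_upwards [hc] with z hz
    simp only [Pi.mul_apply, Pi.div_apply, Pi.pow_apply, Pi.inv_apply, hz]
    field_simp
  · intro z
    by_contra! hz
    have h1 := mul_le_divisor_monomial (k := k) (q := q) hf hz.le
    rw [divisor_apply_of_meromorphic hψ, horder, if_neg hc0] at h1
    have h2 : (1 : ℤ) ≤ q 0 := by exact_mod_cast hq
    simp only [WithTop.untop₀_zero] at h1
    nlinarith

theorem meromorphicOrderAt_monomial_sub_const_ne_top
    (hf : DiffMonomial.IsTranscendentalMeromorphic f) (hq : 1 ≤ q 0) (a z : ℂ) :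
    meromorphicOrderAt (fun z ↦ DiffMonomial.monomial k q f z - a) z ≠ ⊤ := by
  intro h
  apply meromorphicOrderAt_deriv_monomial_ne_top (k := k) hf hq z
  rw [meromorphicOrderAt_eq_top_iff] at h ⊢
  have : DiffMonomial.monomial k q f =ᶠ[𝓝[≠] z] fun _ ↦ a := by
    filter_upwards [h] with w hw
    exact sub_eq_zero.1 hw
  filter_upwards [this.nhdsNE_deriv] with w hw
  simpa using hw

end

section

/-! ### Comparison of the characteristics and of the counting functions -/

variable {f : ℂ → ℂ} {k : ℕ} {q : ℕ → ℕ}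

theorem exists_characteristic_monomial_le (hf : DiffMonomial.IsTranscendentalMeromorphic f)
    (k : ℕ) (q : ℕ → ℕ) :
    ∃ C : ℝ, 0 ≤ C ∧ ∀ r R : ℝ, 1 ≤ r → r < R →
      characteristic (DiffMonomial.monomial k q f) ⊤ r ≤
        (DiffMonomial.mu k q + DiffMonomial.muStar k q) * characteristic f ⊤ r +
          C * log (gauge f r R) := by
  obtain ⟨hm, C, hC0, hC⟩ := isSmall_monomial_div_pow hf k q
  refine ⟨C, hC0, fun r R hr hR ↦ ?_⟩
  set μ := DiffMonomial.mu k q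
  set ν := DiffMonomial.muStar k q
  set ψ := DiffMonomial.monomial k q f
  have heq : ψ =ᶠ[codiscrete ℂ] (ψ / f ^ μ) * f ^ μ := by
    filter_upwards [hf.1.meromorphicOn.eventually_codiscreteWithin_apply_ne_zero (U := univ)
      fun z _ ↦ meromorphicOrderAt_ne_top_of_transcendental hf z] with z hz
    simp only [Pi.mul_apply, Pi.div_apply, Pi.pow_apply]
    rw [div_mul_cancel₀ _ (pow_ne_zero _ hz)]
  have h1 := proximity_mul_top_le hm (hf.1.pow (n := μ)) r
  rw [Pi.add_apply, ← proximity_congr_codiscrete heq (by linarith), proximity_pow_top,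
    Pi.smul_apply, nsmul_eq_mul] at h1
  -- A pole of f of order p gives ψ a pole of order μp + ν ≤ (μ + ν)p, and ψ has no other poles.
  have hdiv : (MeromorphicOn.divisor ψ univ)⁻ ≤ (μ + ν) • (MeromorphicOn.divisor f univ)⁻ := by
    intro z
    have hμ : (0 : ℤ) ≤ μ := Int.natCast_nonneg _
    have hν : (0 : ℤ) ≤ ν := Int.natCast_nonneg _
    rw [coe_nsmul, Pi.smul_apply, nsmul_eq_mul, negPart_apply, negPart_apply]
    push_cast
    rcases lt_or_ge (MeromorphicOn.divisor f univ z) 0 with h | h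
    · have h2 : MeromorphicOn.divisor ψ univ z = μ * MeromorphicOn.divisor f univ z - ν :=
        divisor_monomial_of_neg hf h
      rw [h2, negPart_of_nonpos h.le, negPart_of_nonpos (by nlinarith)]
      nlinarith
    · have h2 : q 0 * MeromorphicOn.divisor f univ z ≤ MeromorphicOn.divisor ψ univ z :=
        mul_le_divisor_monomial hf h
      rw [negPart_of_nonneg h,
        negPart_of_nonneg ((mul_nonneg (Int.natCast_nonneg _) h).trans h2), mul_zero]
  have h2 := logCounting_le hdiv hr
  rw [map_nsmul, Pi.smul_apply, nsmul_eq_mul, ← ValueDistribution.logCounting_top,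
    ← ValueDistribution.logCounting_top] at h2
  push_cast at h2
  have h3 : 0 ≤ (ν : ℝ) * proximity f ⊤ r := mul_nonneg (Nat.cast_nonneg _) (proximity_nonneg r)
  simp only [characteristic, Pi.add_apply]
  linarith [hC r R hr hR]

theorem divisor_logDeriv_of_ne_zero {g : ℂ → ℂ} (hg : Meromorphic g) {z : ℂ}
    (h : MeromorphicOn.divisor g univ z ≠ 0) :
    MeromorphicOn.divisor (logDeriv g) univ z = -1 := by
  rw [divisor_apply_of_meromorphic hg] at h
  rw [divisor_apply_of_meromorphic hg.logDeriv, meromorphicOrderAt_logDeriv_eq_neg_one (hg z)]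
  · rfl
  · intro h'
    simp [h'] at h
  · intro h'
    simp [h'] at h

theorem divisor_logDeriv {g : ℂ → ℂ} (hg : Meromorphic g)
    (htop : ∀ z, meromorphicOrderAt g z ≠ ⊤) (htop' : ∀ z, meromorphicOrderAt (deriv g) z ≠ ⊤) :
    MeromorphicOn.divisor (logDeriv g) univ =
      MeromorphicOn.divisor (deriv g) univ - MeromorphicOn.divisor g univ := by
  have : logDeriv g = deriv g * g⁻¹ := by
    ext z
    simp [logDeriv_apply, div_eq_mul_inv]
  rw [this, MeromorphicOn.divisor_mul hg.deriv.meromorphicOn hg.inv.meromorphicOn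
    (fun z _ ↦ htop' z) (fun z _ ↦ by
      rw [meromorphicOrderAt_inv]
      intro h
      exact htop z (by simpa using congrArg Neg.neg h)), MeromorphicOn.divisor_inv, sub_eq_add_neg]

theorem deriv_monomial_sub_const (k : ℕ) (q : ℕ → ℕ) (f : ℂ → ℂ) (a : ℂ) :
    deriv (fun z ↦ DiffMonomial.monomial k q f z - a) = deriv (DiffMonomial.monomial k q f) := by
  ext z
  exact deriv_sub_const a

/-- At poles of f and at a-points of ψ, the logarithmic derivative has a simple pole. At a zero of
f, q₀ ≥ 1 makes ψ vanish, so ψ - a ≠ 0 as a ≠ 0. There the order is that of ψ', at least μn - ν - 1.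
Elsewhere the order is nonnegative. -/
theorem divisor_inequality (hf : DiffMonomial.IsTranscendentalMeromorphic f) (hq : 1 ≤ q 0)
    {a : ℂ} (ha : a ≠ 0) :
    DiffMonomial.mu k q • (MeromorphicOn.divisor f univ)⁺ -
        MeromorphicOn.divisor (logDeriv fun z ↦ DiffMonomial.monomial k q f z - a) univ ≤
      (DiffMonomial.muStar k q + 1) • (MeromorphicOn.divisor f univ)⁺ +
        (MeromorphicOn.divisor f univ)⁻ + DiffMonomial.reducedPos
          (MeromorphicOn.divisor (fun z ↦ DiffMonomial.monomial k q f z - a) univ) := by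
  intro z
  have hψ := (isControlled_monomial hf k q).1
  have hψa := ((isControlled_monomial hf k q).sub_const a).1
  have hq' : (1 : ℤ) ≤ q 0 := by exact_mod_cast hq
  have hμ : (0 : ℤ) ≤ DiffMonomial.mu k q := Int.natCast_nonneg _
  have hν : (0 : ℤ) ≤ DiffMonomial.muStar k q := Int.natCast_nonneg _
  have hlog := congrArg (fun D ↦ D z) (divisor_logDeriv hψa
    (meromorphicOrderAt_monomial_sub_const_ne_top hf hq a) (by
      rw [deriv_monomial_sub_const]
      exact meromorphicOrderAt_deriv_monomial_ne_top hf hq))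
  have hlog' := divisor_logDeriv_of_ne_zero (z := z) hψa
  rw [deriv_monomial_sub_const] at hlog
  simp only [coe_sub, Pi.sub_apply] at hlog
  have hneg := divisor_monomial_of_neg (k := k) (q := q) (z := z) hf
  have hle := le_divisor_monomial (k := k) (q := q) hf z
  have hmul := mul_le_divisor_monomial (k := k) (q := q) (z := z) hf
  have hsneg := divisor_sub_const_of_neg (z := z) hψ a
  have hspos := divisor_sub_const_of_pos (z := z) hψ ha
  have hsnn := divisor_sub_const_nonneg (z := z) hψ a
  have hd := divisor_deriv_eq_sub_one (z := z) hψ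
  have hd' := divisor_deriv_nonneg (z := z) hψ
  have hred : DiffMonomial.reducedPos
      (MeromorphicOn.divisor (fun z ↦ DiffMonomial.monomial k q f z - a) univ) z =
      if 0 < MeromorphicOn.divisor (fun z ↦ DiffMonomial.monomial k q f z - a) univ z
        then 1 else 0 := rfl
  simp only [coe_sub, coe_add, coe_nsmul, Pi.sub_apply, Pi.add_apply, Pi.smul_apply, posPart_apply,
    negPart_apply, hred]
  rw [nsmul_eq_mul, nsmul_eq_mul]
  push_cast
  generalize MeromorphicOn.divisor (logDeriv fun z ↦ DiffMonomial.monomial k q f z - a) univ z = L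
    at *
  generalize MeromorphicOn.divisor (fun z ↦ DiffMonomial.monomial k q f z - a) univ z = B at *
  generalize MeromorphicOn.divisor (deriv (DiffMonomial.monomial k q f)) univ z = E at *
  generalize MeromorphicOn.divisor (DiffMonomial.monomial k q f) univ z = m at *
  generalize MeromorphicOn.divisor f univ z = n at *
  rcases lt_trichotomy n 0 with h | h | h
  · have hm : m < 0 := by
      rw [hneg h]
      rcases hμ.eq_or_lt with h0 | h0
      · exact absurd (Finset.sum_eq_zero_iff.1 (by exact_mod_cast h0.symm :
          DiffMonomial.mu k q = 0) 0 (by simp)) (by omega)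
      · nlinarith
    have hB := hsneg hm
    rw [posPart_of_nonpos h.le, negPart_of_nonpos h.le, hlog' (by omega), if_neg (by omega)]
    simp only [mul_zero]
    omega
  · subst h
    have hm : 0 ≤ m := by simpa using hmul le_rfl
    rw [posPart_zero, negPart_zero]
    simp only [mul_zero]
    rcases (hsnn hm).eq_or_lt with hB | hB
    · rw [if_neg (by omega)]
      have := hd' hm
      omega
    · rw [if_pos hB, hlog' hB.ne']
      norm_num
  · have h1 := hmul h.le
    have hm : 0 < m := by nlinarith
    have hB := hspos hm
    have hE := hd hm.ne'
    rw [posPart_of_nonneg h.le, negPart_of_nonneg h.le, if_neg (by omega)]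
    nlinarith

theorem exists_mul_characteristic_le (hf : DiffMonomial.IsTranscendentalMeromorphic f)
    (hq : 1 ≤ q 0) {a : ℂ} (ha : a ≠ 0) :
    ∃ C : ℝ, 0 ≤ C ∧ ∀ r R : ℝ, 1 ≤ r → r < R →
      ((DiffMonomial.mu k q : ℝ) - DiffMonomial.muStar k q - 2) * characteristic f ⊤ r ≤
        DiffMonomial.reducedLogCounting (DiffMonomial.monomial k q f) a r +
          C * log (gauge f r R) := by
  have hψ := isControlled_monomial hf k q
  have hψtop := meromorphicOrderAt_monomial_ne_top hf k q
  have hψtop' := meromorphicOrderAt_deriv_monomial_ne_top (k := k) hf hq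
  have hψa := hψ.sub_const a
  have hψatop := meromorphicOrderAt_monomial_sub_const_ne_top (k := k) hf hq a
  have hdiv := divisor_inequality (k := k) hf hq ha
  have hS1 := isSmall_monomial_div_pow hf k q
  have hS2 := hS1.mul (hψ.isSmall_logDeriv hψtop)
  obtain ⟨hhm, C₃, hC₃0, hC₃⟩ := hψa.isSmall_logDeriv hψatop
  obtain ⟨hm₁, C₁, hC₁0, hC₁⟩ := (isSmall_const f a⁻¹).mul hS1
  obtain ⟨hm₂, C₂, hC₂0, hC₂⟩ := (isSmall_const f (-a⁻¹)).mul hS2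
  obtain ⟨A, hA0, hA⟩ := characteristic_inv_le hf.1
  obtain ⟨B, hB0, hB⟩ := characteristic_inv_le hhm
  unfold DiffMonomial.reducedLogCounting
  have hder := deriv_monomial_sub_const k q f a
  set μ := DiffMonomial.mu k q with hμ
  set ν := DiffMonomial.muStar k q
  set ψ := DiffMonomial.monomial k q f
  set h := logDeriv fun z ↦ ψ z - a with hh
  -- The identity a = ψ - (ψ - a), divided by a f^μ, with ψ - a written as ψ · (ψ'/ψ) · h⁻¹.
  have heq : (f ^ μ)⁻¹ =ᶠ[codiscrete ℂ]
      (fun _ ↦ a⁻¹) * (ψ / f ^ μ) + (fun _ ↦ -a⁻¹) * (ψ / f ^ μ * logDeriv ψ) * h⁻¹ := by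
    filter_upwards [hf.1.meromorphicOn.eventually_codiscreteWithin_apply_ne_zero (U := univ)
        fun z _ ↦ meromorphicOrderAt_ne_top_of_transcendental hf z,
      hψ.1.meromorphicOn.eventually_codiscreteWithin_apply_ne_zero (U := univ)
        fun z _ ↦ hψtop z,
      hψ.1.deriv.meromorphicOn.eventually_codiscreteWithin_apply_ne_zero (U := univ)
        fun z _ ↦ hψtop' z] with z h1 h2 h3
    simp only [Pi.mul_apply, Pi.div_apply, Pi.pow_apply, Pi.inv_apply, Pi.add_apply, hh,
      logDeriv_apply, hder, inv_div]
    field_simp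
    ring
  obtain ⟨K, hK0, hK⟩ := exists_const_le_mul_log_gauge f (c := log 2 + B + μ * A + (ν + 1) * A)
    (by have := log_nonneg (show (1 : ℝ) ≤ 2 by norm_num); positivity)
  refine ⟨C₁ + C₂ + C₃ + K, by positivity, fun r R hr hR ↦ ?_⟩
  have h1 : (μ : ℝ) * proximity f⁻¹ ⊤ r ≤
      (C₁ + C₂) * log (gauge f r R) + proximity h⁻¹ ⊤ r + log 2 := by
    have h2 := proximity_add_top_le hm₁ (hm₂.mul hhm.inv) r
    have h3 := proximity_mul_top_le hm₂ hhm.inv r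
    rw [← proximity_congr_codiscrete heq (by linarith), ← inv_pow, proximity_pow_top] at h2
    simp only [Pi.add_apply, Pi.smul_apply, nsmul_eq_mul] at h2 h3
    linarith [hC₁ r R hr hR, hC₂ r R hr hR]
  -- Jensen's formula for h: T(r, 1/h) ≤ T(r, h) + B, with the poles of h moved to the left and m(r,
  -- h) an error term.
  have h2 : proximity h⁻¹ ⊤ r + logCounting (MeromorphicOn.divisor h univ) r ≤
      C₃ * log (gauge f r R) + B := by
    have h3 := (abs_le.1 (hB r)).1
    rw [log_counting_zero_sub_logCounting_top, Pi.sub_apply]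
    simp only [characteristic, Pi.add_apply, ValueDistribution.logCounting_inv] at h3
    linarith [hC₃ r R hr hR]
  have h3 := logCounting_le hdiv hr
  simp only [map_add, map_sub, map_nsmul, Pi.add_apply, Pi.sub_apply, Pi.smul_apply]
    at h3
  rw [nsmul_eq_mul, nsmul_eq_mul] at h3
  rw [← ValueDistribution.logCounting_top, ← ValueDistribution.logCounting_zero] at h3
  push_cast at h3
  have h4 : characteristic f⁻¹ ⊤ r = proximity f⁻¹ ⊤ r + ValueDistribution.logCounting f 0 r := by
    rw [← ValueDistribution.logCounting_inv]
    rfl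
  have h5 : 0 ≤ proximity f⁻¹ ⊤ r := proximity_nonneg r
  have h6 := logCounting_le_characteristic (f := f) (r := r)
  obtain ⟨h7, h8⟩ := abs_le.1 (hA r)
  have h9 : (μ : ℝ) * (characteristic f ⊤ r - A) ≤ μ * characteristic f⁻¹ ⊤ r :=
    mul_le_mul_of_nonneg_left (by linarith) (Nat.cast_nonneg _)
  have h10 : ((ν : ℝ) + 1) * ValueDistribution.logCounting f 0 r ≤
      (ν + 1) * (characteristic f ⊤ r + A) :=
    mul_le_mul_of_nonneg_left (by linarith) (by positivity)
  rw [h4] at h9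
  linarith [hK r R hr hR]

/-! ### Passage to the upper limit. -/

theorem exists_reducedLogCounting_le {g : ℂ → ℂ} (hg : Meromorphic g) (a : ℂ) :
    ∃ C : ℝ, ∀ r : ℝ, 1 ≤ r →
      DiffMonomial.reducedLogCounting g a r ≤ characteristic g ⊤ r + C := by
  have hga : Meromorphic fun z ↦ g z - a := fun z ↦ (hg z).sub (.const a z)
  obtain ⟨A, hA0, hA⟩ := characteristic_inv_le hga
  refine ⟨A + (log⁺ ‖a‖ + log 2), fun r hr ↦ ?_⟩
  have h1 : DiffMonomial.reducedPos (MeromorphicOn.divisor (fun z ↦ g z - a) univ) ≤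
      (MeromorphicOn.divisor (fun z ↦ g z - a) univ)⁺ := by
    intro z
    change (if 0 < MeromorphicOn.divisor (fun z ↦ g z - a) univ z then (1 : ℤ) else 0) ≤ _
    rw [posPart_apply]
    split_ifs with h
    · exact le_trans (Int.add_one_le_iff.2 h) (le_posPart _)
    · exact posPart_nonneg _
  have h2 := logCounting_le h1 hr
  rw [← ValueDistribution.logCounting_zero, ← ValueDistribution.logCounting_inv] at h2
  have h3 := logCounting_le_characteristic (f := (fun z ↦ g z - a)⁻¹) (r := r)
  have h4 := (abs_le.1 (hA r)).1
  have h5 := (abs_le.1 (abs_characteristic_sub_characteristic_shift_le (a₀ := a) (r := r) hg)).1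
  unfold DiffMonomial.reducedLogCounting
  linarith

theorem le_limsup_reducedLogCounting (hf : DiffMonomial.IsTranscendentalMeromorphic f)
    (hq : 1 ≤ q 0)
    (hmu : (3 : ℤ) ≤ (DiffMonomial.mu k q : ℤ) - (DiffMonomial.muStar k q : ℤ))
    {a : ℂ} (ha : a ≠ 0) :
    ((((DiffMonomial.mu k q : ℝ) - (DiffMonomial.muStar k q : ℝ) - 2) /
        ((DiffMonomial.mu k q : ℝ) + (DiffMonomial.muStar k q : ℝ)) : ℝ) : EReal) ≤
      limsup (fun r : ℝ ↦ ((DiffMonomial.reducedLogCounting (DiffMonomial.monomial k q f) a r /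
        characteristic (DiffMonomial.monomial k q f) ⊤ r : ℝ) : EReal)) atTop := by
  obtain ⟨C₁, hC₁0, hC₁⟩ := exists_characteristic_monomial_le hf k q
  obtain ⟨C₂, hC₂0, hC₂⟩ := exists_mul_characteristic_le (k := k) hf hq ha
  obtain ⟨C₃, hC₃⟩ := exists_reducedLogCounting_le (isControlled_monomial hf k q).1 a
  have hmu' : (3 : ℝ) ≤ (DiffMonomial.mu k q : ℝ) - DiffMonomial.muStar k q := by
    exact_mod_cast hmu
  have hν : (0 : ℝ) ≤ DiffMonomial.muStar k q := Nat.cast_nonneg _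
  have hs : (0 : ℝ) < DiffMonomial.mu k q + DiffMonomial.muStar k q := by linarith
  set s : ℝ := DiffMonomial.mu k q + DiffMonomial.muStar k q
  set d : ℝ := (DiffMonomial.mu k q : ℝ) - DiffMonomial.muStar k q - 2 with hd
  set N := DiffMonomial.reducedLogCounting (DiffMonomial.monomial k q f) a
  set T := characteristic f ⊤ with hT
  set S := characteristic (DiffMonomial.monomial k q f) ⊤
  have hlim : Tendsto T atTop atTop := tendsto_characteristic_atTop hf
  rw [← EReal.ge_of_forall_gt_iff_ge]
  intro b hb
  rw [EReal.coe_lt_coe_iff, lt_div_iff₀ hs] at hb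
  -- A nonnegative multiplier is needed to carry the upper bound on T(r, ψ) through the product.
  -- Since d > 0, it still satisfies b' s < d.
  set b' := max b 0 with hb'
  have hb0 : 0 ≤ b' := le_max_right _ _
  have hbs : b' * s < d := by
    rcases max_cases b 0 with h | h <;> rw [hb', h.1]
    · exact hb
    · linarith
  -- The gap d - b' s pays for both error terms and, through the extra 1, for the constant C₃, which
  -- is below ε T(r, f) at the chosen radii.
  set ε := (d - b' * s) / (b' * C₁ + C₂ + 1) with hε
  have hden : 0 < b' * C₁ + C₂ + 1 := by positivity
  have hε0 : 0 < ε := div_pos (by linarith) hden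
  have hεd : ε * (b' * C₁ + C₂ + 1) = d - b' * s := div_mul_cancel₀ _ hden.ne'
  refine le_limsup_of_frequently_le' ?_
  refine ((frequently_log_gauge_le hf hε0).and_eventually ((eventually_ge_atTop 1).and
    ((hlim.eventually_gt_atTop (C₃ / ε)).and (hlim.eventually_gt_atTop 0)))).mono ?_
  rintro r ⟨h1, h2, h3, h4⟩
  have hR : r < r + 1 / T r := by
    have : 0 < 1 / T r := one_div_pos.2 h4
    linarith
  have h5 := hC₁ r _ h2 hR
  have h6 := hC₂ r _ h2 hR
  have h7 := hC₃ r h2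
  have h8 := mul_le_mul_of_nonneg_left h1 hC₁0
  have h9 := mul_le_mul_of_nonneg_left h1 hC₂0
  rw [div_lt_iff₀ hε0] at h3
  have h10 : d * T r = b' * s * T r + b' * C₁ * ε * T r + C₂ * ε * T r + ε * T r := by
    linear_combination -(T r) * hεd
  have h11 : 0 ≤ b' * s * T r := by positivity
  have h12 : 0 ≤ b' * C₁ * ε * T r := by positivity
  -- Positivity of T(r, ψ) follows from N̄ ≤ T(r, ψ) + C₃ and the lower bound for N̄. It is what
  -- permits dividing by T(r, ψ).
  have hS : 0 < S r := by linarith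
  rw [EReal.coe_le_coe_iff, le_div_iff₀ hS]
  have h13 : b * S r ≤ b' * S r := mul_le_mul_of_nonneg_right (le_max_left _ _) hS.le
  have h14 : b' * S r ≤ b' * (s * T r + C₁ * (ε * T r)) :=
    mul_le_mul_of_nonneg_left (by linarith) hb0
  have h15 : 0 ≤ ε * T r := by positivity
  linarith

end

end Nevanlinna

end

theorem theorem5p2 (f : ℂ → ℂ) (hf : DiffMonomial.IsTranscendentalMeromorphic f)
    (k : ℕ) (hk : 1 ≤ k) (q : ℕ → ℕ) (hq0 : 1 ≤ q 0) (hqk : 1 ≤ q k)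
    (hmu : (3 : ℤ) ≤ (DiffMonomial.mu k q : ℤ) - (DiffMonomial.muStar k q : ℤ))
    (a : ℂ) (ha : a ≠ 0) :
    DiffMonomial.ramificationIndex a (DiffMonomial.monomial k q f) ≤
      ((1 - ((DiffMonomial.mu k q : ℝ) - (DiffMonomial.muStar k q : ℝ) - 2) /
        ((DiffMonomial.mu k q : ℝ) + (DiffMonomial.muStar k q : ℝ)) : ℝ) : EReal) := by
  rw [EReal.coe_sub]
  exact EReal.sub_le_sub le_rfl (Nevanlinna.le_limsup_reducedLogCounting hf hq0 hmu ha)
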